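/- Let $S=\mathbb Z$ or $S=\mathbb N=\{1,2,3,\dots\}$. For a function $V:S\to\mathbb R$ let $H_V$ be the self-adjoint operator in $\ell^2(S)$ given by $(H_V\psi)(n)=\psi(n-1)+\psi(n+1)+V(n)\psi(n)$ on its maximal domain, with the Dirichlet condition $\psi(0)=0$ if $S=\mathbb N$. Let $A(n,z)=\begin{pmatrix} z-V(n) & -1\\ 1 & 0\end{pmatrix}$, and let $T_V(n,m;z)=A(n,z)A(n-1,z)\cdots A(m+1,z)$ for $n>m$, $T_V(n,n;z)=I$, and $T_V(n,m;z)=T_V(m,n;z)^{-1}$ for $n<m$. With $\psi(t)=e^{-itH_V}\delta_1$ put, for $T>0$, $p>0$, $$a_V(n,T)=\frac1T\int_0^\infty e^{-2t/T}|\psi(t,n)|^2\,dt,\qquad \langle |X|^p\rangle_V(T)=\sum_{n\in S}|n|^p a_V(n,T),\qquad \beta_V^-(p)=\liminf_{T\to\infty}\frac{\log\langle |X|^p\rangle_V(T)}{\log T}.$$ Let $V_0:S\to\mathbb R$, let $W:S\to\mathbb R$ be finitely supported, and let $V=V_0+W$, so that $H_V=H_{V_0}+W$. (1) Let $K,C,\alpha>0$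 and let $A(N)\subset\mathbb R$, $N>0$, be sets such that for all $N$ large enough, $A(N)$ is a nonempty Borel subset of $[-K,K]$ and $\|T_{V_0}(n,m;E)\|\le CN^{\alpha}$ for all $E\in A(N)$ and all $n,m\in S$ with $|n|\le N$, $|m|\le N$. Let $N(T)=T^{1/(1+\alpha)}$ and $B(T)=\{E\in\mathbb R:\exists E'\in A(N(T)),\ |E-E'|\le 1/T\}$. Then there is $T_0>1$ such that the following holds. There is a constant $\hat C>0$ with $$\sum_{n\in S,\ |n|\ge N(T)/2}a_V(n,T)\ \ge\ \frac{\hat C}{T}\,|B(T)|\,N(T)^{1-2\alpha}\qquad\text{for all }T\ge T_0,$$ and for every $p>0$ there is a constant $\hat C_p>0$ with $$\langle |X|^p\rangle_V(T)\ \ge\ \frac{\hat C_p}{T}\,|B(T)|\,N(T)^{p+1-2\alpha}\qquad\text{for all }T\ge T_0.$$ Here $|B|$ is the Lebesgue measure of $B$. (2) If for some $E_0\in\mathbb R$, $C$ and $\alpha\ge0$ one has $\|T_{V_0}(n,m;E_0)\|\le C(|n|+|m|)^{\alpha}$ for all $n,m\in S$ with $(n,m)\ne(0,0)$, then $\beta_V^-(p)\ge\frac{p-1-4\alpha}{1+\alpha}$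 for every $p>0$. (3) If for some $C>0$, $E_0\in\mathbb R$ and $\theta\ge1$ one has $\|T_{V_0}(n,1;E)\|\le C$ for all $n\in S\setminus\{0\}$ and $E\in\mathbb R$ with $|n|\cdot|E-E_0|^{\theta}\le1$, then $\beta_V^-(p)\ge p-\frac1\theta$ for every $p>0$. -/

import Mathlib

open MeasureTheory Filter Topology
open scoped ENNReal Matrix.Norms.L2Operator

namespace Schrodinger

/-- The Hilbert space `ℓ²(S)` for a set `S ⊆ ℤ` of sites. The whole line is `S = ℤ`, the half line
`ℕ = {1, 2, …}` is `S = [1, ∞)`. -/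
noncomputable abbrev L2 (S : Set ℤ) := lp (fun _ : S => ℂ) 2

open Classical in
/-- Extension of a function on `S` to `ℤ` by zero; on the half line this is the Dirichlet condition
`u 0 = 0`. -/
noncomputable def zeroExt {S : Set ℤ} {R : Type} [Zero R] (u : S → R) (k : ℤ) : R :=
  if h : k ∈ S then u ⟨k, h⟩ else 0

/-- The formal action `(Hu)(n) = u(n-1) + u(n+1) + V(n) u(n)`, with `u = 0` outside `S`. -/
noncomputable def formalH {S : Set ℤ} (V : S → ℝ) (u : S → ℂ) (n : S) : ℂ :=
  zeroExt u (n - 1) + zeroExt u (n + 1) + V n * u n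

section aux
variable {S : Set ℤ}

theorem zeroExt_coe {R : Type} [Zero R] (u : S → R) (n : S) : zeroExt u n = u n := by
  simp [zeroExt]

theorem zeroExt_add (u v : S → ℂ) (k : ℤ) : zeroExt (u + v) k = zeroExt u k + zeroExt v k := by
  by_cases hk : k ∈ S <;> simp [zeroExt, hk]

theorem zeroExt_smul (c : ℂ) (u : S → ℂ) (k : ℤ) : zeroExt (c • u) k = c * zeroExt u k := by
  by_cases hk : k ∈ S <;> simp [zeroExt, hk]

theorem zeroExt_of_notMem {R : Type} [Zero R] (u : S → R) {k : ℤ} (hk : k ∉ S) :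
    zeroExt u k = 0 := by simp [zeroExt, hk]

theorem hasSum_zeroExt (u : L2 S) : HasSum (fun k : ℤ => ‖zeroExt u k‖ ^ 2) (‖u‖ ^ 2) := by
  have h := lp.hasSum_norm (p := 2) (by norm_num) u
  simp only [ENNReal.toReal_ofNat, Real.rpow_ofNat] at h
  rw [← Subtype.val_injective.hasSum_iff (f := fun k : ℤ => ‖zeroExt u k‖ ^ 2)]
  · convert! h using 2 with n
    simp [zeroExt_coe]
  · intro k hk
    rw [zeroExt_of_notMem]
    · simp
    · intro h; exact hk ⟨⟨k, h⟩, rfl⟩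

/-- The shift by `j` with zero boundary conditions outside `S`. -/
noncomputable def shift (S : Set ℤ) (j : ℤ) : L2 S →L[ℂ] L2 S :=
  have key (u : L2 S) (s : Finset S) : ∑ n ∈ s, ‖zeroExt u (n + j)‖ ^ 2 ≤ ‖u‖ ^ 2 := by
    have hinj : Function.Injective (fun n : S => (n : ℤ) + j) := fun a b h => by
      simpa [Subtype.ext_iff] using h
    calc _ = ∑ k ∈ s.map ⟨_, hinj⟩, ‖zeroExt u k‖ ^ 2 := by simp
      _ ≤ _ := sum_le_hasSum _ (fun _ _ => by positivity) (hasSum_zeroExt u)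
  LinearMap.mkContinuous
    { toFun := fun u => ⟨fun n => zeroExt u (n + j), by
        refine memℓp_gen' (C := ‖u‖ ^ 2) fun s => ?_
        simpa using key u s⟩
      map_add' := fun u v => by ext n; exact zeroExt_add _ _ _
      map_smul' := fun c u => by ext n; exact zeroExt_smul _ _ _ } 1 fun u => by
    refine lp.norm_le_of_forall_sum_le (by norm_num) (by positivity) fun s => ?_
    simpa using key u s

theorem shift_apply (j : ℤ) (u : L2 S) (n : S) : shift S j u n = zeroExt u (n + j) := rfl

theorem inner_shift (j : ℤ) (u v : L2 S) :
    inner ℂ (shift S j u) v = inner ℂ u (shift S (-j) v) := by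
  have h1 : inner ℂ (shift S j u) v =
      ∑' k : ℤ, inner ℂ (zeroExt u (k + j)) (zeroExt v k) := by
    rw [lp.inner_eq_tsum, ← (Subtype.val_injective (p := (· ∈ S))).tsum_eq
      (f := fun k : ℤ => inner ℂ (zeroExt u (k + j)) (zeroExt v k))]
    · simp only [zeroExt_coe, shift_apply]
    · intro k hk
      by_contra h
      refine hk ?_
      simp only
      rw [zeroExt_of_notMem v (k := k) (fun hs => h ⟨⟨k, hs⟩, rfl⟩), inner_zero_right]
  have h2 : inner ℂ u (shift S (-j) v) =
      ∑' k : ℤ, inner ℂ (zeroExt u k) (zeroExt v (k + -j)) := by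
    rw [lp.inner_eq_tsum, ← (Subtype.val_injective (p := (· ∈ S))).tsum_eq
      (f := fun k : ℤ => inner ℂ (zeroExt u k) (zeroExt v (k + -j)))]
    · simp only [zeroExt_coe, shift_apply]
    · intro k hk
      by_contra h
      refine hk ?_
      simp only
      rw [zeroExt_of_notMem u (k := k) (fun hs => h ⟨⟨k, hs⟩, rfl⟩), inner_zero_left]
  rw [h1, h2, ← (Equiv.addRight j).tsum_eq
    (fun k : ℤ => inner ℂ (zeroExt u k) (zeroExt v (k + -j)))]
  simp

/-- The hopping part of the operator. -/
noncomputable def hop (S : Set ℤ) : L2 S →L[ℂ] L2 S := shift S (-1) + shift S 1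

theorem hop_apply (u : L2 S) (n : S) : hop S u n = zeroExt u (n - 1) + zeroExt u (n + 1) := rfl

theorem inner_hop (u v : L2 S) : inner ℂ (hop S u) v = inner ℂ u (hop S v) := by
  rw [hop, add_apply, add_apply, inner_add_left, inner_add_right, inner_shift, inner_shift, neg_neg,
    add_comm]

end aux

theorem formalH_add {S : Set ℤ} (V : S → ℝ) (u v : S → ℂ) :
    formalH V (u + v) = formalH V u + formalH V v := by
  ext n
  simp only [formalH, zeroExt_add, Pi.add_apply]
  ring

theorem formalH_smul {S : Set ℤ} (V : S → ℝ) (c : ℂ) (u : S → ℂ) :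
    formalH V (c • u) = c • formalH V u := by
  ext n
  simp only [formalH, zeroExt_smul, Pi.smul_apply, smul_eq_mul]
  ring

/-- The Schrödinger operator `H` with real potential `V` in `ℓ²(S)`, on its natural (maximal) domain
`{u ∈ ℓ²(S) | Hu ∈ ℓ²(S)}`. The potential may be unbounded. On this domain `H` is self-adjoint. -/
noncomputable def hamiltonian {S : Set ℤ} (V : S → ℝ) : L2 S →ₗ.[ℂ] L2 S where
  domain :=
    { carrier := {u | Memℓp (formalH V u) 2}
      add_mem' := fun {u v} hu hv => by
        change Memℓp (formalH V ((u : S → ℂ) + v)) 2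
        rw [formalH_add]
        exact Memℓp.add hu hv
      zero_mem' := by
        have h : formalH V (0 : S → ℂ) = 0 := by simpa using formalH_smul V 0 0
        change Memℓp (formalH V (0 : S → ℂ)) 2
        rw [h]
        exact zero_memℓp
      smul_mem' := fun c u hu => by
        change Memℓp (formalH V (c • (u : S → ℂ))) 2
        rw [formalH_smul]
        exact Memℓp.const_smul hu c }
  toFun :=
    { toFun := fun u => ⟨formalH V u, u.2⟩
      map_add' := fun u v => Subtype.ext (formalH_add V u v)
      map_smul' := fun c u => Subtype.ext (formalH_smul V c u) }

section
variable {S : Set ℤ}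

theorem hamiltonian_apply (V : S → ℝ) (u : (hamiltonian V).domain) (n : S) :
    hamiltonian V u n = hop S u n + V n * (u : L2 S) n := rfl

theorem mem_domain {V : S → ℝ} {u : L2 S} (f : L2 S)
    (h : ∀ n, f n = hop S u n + V n * u n) : u ∈ (hamiltonian V).domain := by
  change Memℓp (formalH V u) 2
  have : formalH V u = f := funext fun n => (h n).symm
  rw [this]; exact lp.memℓp f

theorem inner_hamiltonian (V : S → ℝ) (u v : (hamiltonian V).domain) :
    inner ℂ (hamiltonian V u) (v : L2 S) = inner ℂ (u : L2 S) (hamiltonian V v) := by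
  have h1 := (lp.hasSum_inner (𝕜 := ℂ) (hamiltonian V u) (v : L2 S)).sub
    (lp.hasSum_inner (𝕜 := ℂ) (hop S u) (v : L2 S))
  have h2 := (lp.hasSum_inner (𝕜 := ℂ) (u : L2 S) (hamiltonian V v)).sub
    (lp.hasSum_inner (𝕜 := ℂ) (u : L2 S) (hop S v))
  have h3 := h1.unique (by
    convert! h2 using 2 with n
    simp only [hamiltonian_apply, RCLike.inner_apply, map_add, map_mul, Complex.conj_ofReal]
    ring)
  rw [inner_hop] at h3
  linear_combination h3

/-- `ψ` solves the Schrödinger equation `i ψ'(t) = H ψ(t)`, `ψ(0) = φ`, for all real times: `ψ(t)`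
lies in the domain of `H` and the derivative is taken in the norm of `ℓ²(S)`. -/
def IsSchrodingerSolution (V : S → ℝ) (φ : L2 S) (ψ : ℝ → L2 S) : Prop :=
  ψ 0 = φ ∧ ∀ t, ∃ h : ψ t ∈ (hamiltonian V).domain,
    HasDerivAt ψ (-Complex.I • hamiltonian V ⟨ψ t, h⟩) t

theorem IsSchrodingerSolution.norm_eq {V : S → ℝ} {φ : L2 S} {ψ : ℝ → L2 S}
    (h : IsSchrodingerSolution V φ ψ) (t : ℝ) : ‖ψ t‖ = ‖φ‖ := by
  have hd (s : ℝ) : HasDerivAt (fun r => (inner ℂ (ψ r) (ψ r) : ℂ)) 0 s := by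
    obtain ⟨hs, hds⟩ := h.2 s
    convert! hds.inner ℂ hds using 1
    have := inner_hamiltonian V ⟨ψ s, hs⟩ ⟨ψ s, hs⟩
    simp only [inner_smul_left, inner_smul_right, map_neg, Complex.conj_I] at this ⊢
    rw [this]; ring
  have := is_const_of_deriv_eq_zero (fun s => (hd s).differentiableAt) (fun s => (hd s).deriv) t 0
  simp only [h.1, inner_self_eq_norm_sq_to_K] at this
  have h2 : ‖ψ t‖ ^ 2 = ‖φ‖ ^ 2 := by exact_mod_cast this
  exact (pow_left_inj₀ (norm_nonneg _) (norm_nonneg _) two_ne_zero).1 h2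

theorem IsSchrodingerSolution.unique {V : S → ℝ} {φ : L2 S} {ψ χ : ℝ → L2 S}
    (h : IsSchrodingerSolution V φ ψ) (h' : IsSchrodingerSolution V φ χ) : ψ = χ := by
  have hs : IsSchrodingerSolution V 0 (ψ - χ) := by
    refine ⟨by simp [h.1, h'.1], fun t => ?_⟩
    obtain ⟨m, d⟩ := h.2 t
    obtain ⟨m', d'⟩ := h'.2 t
    refine ⟨Submodule.sub_mem _ m m', ?_⟩
    convert! d.sub d' using 1
    rw [← smul_sub, ← LinearPMap.map_sub]
    rfl
  ext1 t
  have := hs.norm_eq t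
  rw [norm_zero, norm_eq_zero] at this
  exact sub_eq_zero.1 this

/-- Multiplication by `exp (i t V)`. -/
noncomputable def phase (V : S → ℝ) (t : ℝ) : L2 S →L[ℂ] L2 S :=
  LinearMap.mkContinuous
    { toFun := fun u => ⟨fun n => Complex.exp (t * V n * Complex.I) * u n, by
        refine memℓp_gen' (C := ‖u‖ ^ 2) fun s => ?_
        have := lp.sum_rpow_le_norm_rpow (p := 2) (by norm_num) u s
        have he (n : S) := Complex.norm_exp_ofReal_mul_I (t * V n)
        push_cast at he
        simpa [he] using this⟩
      map_add' := fun u v => by ext n; exact mul_add _ _ _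
      map_smul' := fun c u => by ext n; simp; ring } 1 fun u => by
    refine lp.norm_le_of_forall_sum_le (by norm_num) (by positivity) fun s => ?_
    have := lp.sum_rpow_le_norm_rpow (p := 2) (by norm_num) u s
    have he (n : S) := Complex.norm_exp_ofReal_mul_I (t * V n)
    push_cast at he
    simpa [he] using this

theorem phase_apply (V : S → ℝ) (t : ℝ) (u : L2 S) (n : S) :
    phase V t u n = Complex.exp (t * V n * Complex.I) * u n := rfl

theorem norm_phase_le (V : S → ℝ) (t : ℝ) (u : L2 S) : ‖phase V t u‖ ≤ ‖u‖ := by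
  have := (LinearMap.mkContinuous_norm_le _ zero_le_one _ : ‖phase V t‖ ≤ 1)
  exact (phase V t).le_of_opNorm_le this u |>.trans_eq (one_mul _)

theorem continuous_phase_left (V : S → ℝ) (u : L2 S) : Continuous fun t => phase V t u := by
  classical
  have hs := lp.hasSum_single (by norm_num) u
  have : TendstoUniformly (fun (s : Finset S) t => phase V t (∑ n ∈ s, lp.single 2 n (u n)))
      (fun t => phase V t u) atTop := by
    rw [Metric.tendstoUniformly_iff]
    intro ε hε
    filter_upwards [(Metric.tendsto_nhds.1 hs) ε hε] with s hs t
    rw [dist_eq_norm, ← map_sub]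
    refine (norm_phase_le _ _ _).trans_lt ?_
    rwa [dist_comm, dist_eq_norm] at hs
  refine this.continuous (Eventually.of_forall fun s => ?_).frequently
  simp only [map_sum]
  refine continuous_finsetSum _ fun n _ => ?_
  have : (fun t => phase V t (lp.single 2 n (u n))) =
      fun t : ℝ => lp.single 2 n (Complex.exp (t * V n * Complex.I) * u n) := by
    ext t m
    rw [phase_apply]
    by_cases hm : m = n
    · subst hm; simp
    · simp [lp.single_apply, hm]
  rw [this]
  exact (lp.isometry_single (E := fun _ : S => ℂ) (p := 2) n).continuous.comp (by fun_prop)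

theorem continuous_phase {X : Type} [TopologicalSpace X] (V : S → ℝ) {f : X → ℝ} {u : X → L2 S}
    (hf : Continuous f) (hu : Continuous u) : Continuous fun x => phase V (f x) (u x) := by
  rw [continuous_iff_continuousAt]
  intro x
  rw [ContinuousAt, tendsto_iff_norm_sub_tendsto_zero]
  have h1 : Tendsto (fun y => ‖u y - u x‖ + ‖phase V (f y) (u x) - phase V (f x) (u x)‖)
      (𝓝 x) (𝓝 0) := by
    have a := (tendsto_iff_norm_sub_tendsto_zero.1 (hu.tendsto x))
    have b := tendsto_iff_norm_sub_tendsto_zero.1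
      (((continuous_phase_left V (u x)).comp hf).tendsto x)
    simpa using a.add b
  refine squeeze_zero (fun _ => norm_nonneg _) (fun y => ?_) h1
  calc _ = ‖phase V (f y) (u y - u x) + (phase V (f y) (u x) - phase V (f x) (u x))‖ := by
        rw [map_sub]; congr 1; abel
    _ ≤ _ := (norm_add_le _ _).trans (by gcongr; exact norm_phase_le _ _ _)

/-- The terms of the Dyson series of the equation `χ' = F χ`, `χ(0) = x`. -/
noncomputable def dyson {E : Type} [NormedAddCommGroup E] [NormedSpace ℝ E] (F : ℝ → E → E) (x : E) : ℕ → ℝ → E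
  | 0 => fun _ => x
  | k + 1 => fun t => ∫ s in (0 : ℝ)..t, F s (dyson F x k s)

theorem exists_linear_ode {E : Type} [NormedAddCommGroup E] [NormedSpace ℝ E] [CompleteSpace E] (F : ℝ → E →L[ℝ] E) (c : ℝ) (hc : 0 ≤ c)
    (hF : ∀ t u, ‖F t u‖ ≤ c * ‖u‖)
    (hcont : ∀ u : ℝ → E, Continuous u → Continuous fun t => F t (u t)) (x : E) :
    ∃ χ : ℝ → E, χ 0 = x ∧ ∀ t, HasDerivAt χ (F t (χ t)) t := by
  set g := dyson (fun t => F t) x with hg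
  have gsucc (k : ℕ) (t : ℝ) : g (k + 1) t = ∫ s in (0 : ℝ)..t, F s (g k s) := rfl
  have hgc (k : ℕ) : Continuous (g k) := by
    induction k with
    | zero => exact continuous_const
    | succ k ih =>
      exact intervalIntegral.continuous_primitive
        (fun a b => (hcont _ ih).intervalIntegrable a b) 0
  have hgd (k : ℕ) (t : ℝ) : HasDerivAt (g (k + 1)) (F t (g k t)) t :=
    intervalIntegral.integral_hasDerivAt_right ((hcont _ (hgc k)).intervalIntegrable _ _)
      ((hcont _ (hgc k)).stronglyMeasurableAtFilter _ _) (hcont _ (hgc k)).continuousAt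
  have hgb (k : ℕ) (t : ℝ) : ‖g k t‖ ≤ (c * |t|) ^ k / k.factorial * ‖x‖ := by
    induction k generalizing t with
    | zero => simp [hg, dyson]
    | succ k ih =>
      rw [gsucc]
      have h1 : ∀ s, ‖F s (g k s)‖ ≤ c ^ (k + 1) / k.factorial * ‖x‖ * |s - 0| ^ k := fun s => by
        refine (hF _ _).trans ((mul_le_mul_of_nonneg_left (ih s) hc).trans_eq ?_)
        rw [sub_zero]; ring
      refine (intervalIntegral.norm_integral_le_abs_of_norm_le (μ := volume)
        (ae_of_all _ fun s => h1 s) (Continuous.intervalIntegrable (by fun_prop) _ _)).trans_eq ?_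
      rw [intervalIntegral.integral_const_mul, abs_mul, intervalIntegral.abs_intervalIntegral_eq,
        integral_pow_abs_sub_uIoc, Nat.factorial_succ, abs_of_nonneg (by positivity),
        abs_of_nonneg (by positivity)]
      push_cast
      rw [sub_zero, mul_pow]
      field_simp
  have hsum (M : ℝ) : Summable fun k : ℕ => (c * M) ^ k / k.factorial * ‖x‖ :=
    (Real.summable_pow_div_factorial _).mul_right _
  have hsg (t : ℝ) : Summable fun k => g k t := .of_norm_bounded (hsum |t|) fun k => hgb k t
  refine ⟨fun t => ∑' k, g k t, ?_, fun t => ?_⟩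
  · simp only
    rw [tsum_eq_single 0]
    · rfl
    · intro k hk
      obtain ⟨k, rfl⟩ := Nat.exists_eq_succ_of_ne_zero hk
      simp [gsucc]
  · have h0 : (fun t => ∑' k, g k t) = fun t => x + ∑' k, g (k + 1) t := by
      ext1 t
      rw [(hsg t).tsum_eq_zero_add]; rfl
    rw [h0]
    have e : F t (x + ∑' k, g (k + 1) t) = ∑' k, F t (g k t) := by
      rw [← (F t).map_tsum (hsg t), (hsg t).tsum_eq_zero_add]; rfl
    rw [e]
    refine HasDerivAt.const_add x ?_
    have hpos : 0 < |t| + 1 := by positivity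
    have hbd (k : ℕ) (y : ℝ) (hy : y ∈ Metric.ball (0 : ℝ) (|t| + 1)) :
        ‖F y (g k y)‖ ≤ c * ((c * (|t| + 1)) ^ k / k.factorial * ‖x‖) := by
      refine (hF _ _).trans (mul_le_mul_of_nonneg_left ((hgb k y).trans ?_) hc)
      have : |y| ≤ |t| + 1 := by simpa using (mem_ball_zero_iff.1 hy).le
      gcongr
    have hs0 : Summable fun k => g (k + 1) 0 := by simp [gsucc, summable_zero]
    have ht : t ∈ Metric.ball (0 : ℝ) (|t| + 1) := by
      rw [mem_ball_zero_iff, Real.norm_eq_abs]; linarith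
    exact hasDerivAt_tsum_of_isPreconnected ((hsum (|t| + 1)).mul_left c)
      Metric.isOpen_ball (convex_ball _ _).isPreconnected (fun k y _ => hgd k y)
      hbd (Metric.mem_ball_self hpos) hs0 ht

theorem exists_solution (V : S → ℝ) (φ : (hamiltonian V).domain) :
    ∃ ψ, IsSchrodingerSolution V φ ψ := by
  set y : L2 S := -Complex.I • hamiltonian V φ with hy
  have bound (t : ℝ) (u : L2 S) :
      ‖(-Complex.I • (phase V t ∘L hop S ∘L phase V (-t))) u‖ ≤ ‖hop S‖ * ‖u‖ := by
    simp only [neg_smul, neg_apply, smul_apply,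
      norm_neg, norm_smul, Complex.norm_I, one_mul, ContinuousLinearMap.comp_apply]
    refine (norm_phase_le _ _ _).trans (((hop S).le_opNorm _).trans ?_)
    gcongr
    exact norm_phase_le _ _ _
  obtain ⟨χ, hχ0, hχ⟩ := exists_linear_ode
    (fun t => (-Complex.I • (phase V t ∘L hop S ∘L phase V (-t))).restrictScalars ℝ) ‖hop S‖ (norm_nonneg _) bound
    (fun u hu => (continuous_phase V continuous_id ((hop S).continuous.comp
        (continuous_phase V continuous_neg hu))).const_smul (-Complex.I)) y
  have hχc : Continuous χ := continuous_iff_continuousAt.2 fun t => (hχ t).continuousAt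
  set η : ℝ → L2 S := fun t => phase V (-t) (χ t) with hη
  have hηc : Continuous η := continuous_phase V continuous_neg hχc
  set ψ : ℝ → L2 S := fun t => φ + ∫ s in (0 : ℝ)..t, η s with hψ
  have hψd (t : ℝ) : HasDerivAt ψ (η t) t :=
    (intervalIntegral.integral_hasDerivAt_right (hηc.intervalIntegrable _ _)
      (hηc.stronglyMeasurableAtFilter _ _) hηc.continuousAt).const_add _
  have coord (f : ℝ → L2 S) (f' : L2 S) (t : ℝ) (n : S) (h : HasDerivAt f f' t) :
      HasDerivAt (fun s => f s n) (f' n) t :=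
    ((lp.evalCLM ℂ (fun _ : S => ℂ) 2 n).restrictScalars ℝ).hasFDerivAt.comp_hasDerivAt t h
  have hhop (t : ℝ) : HasDerivAt (fun s => hop S (ψ s)) (hop S (η t)) t :=
    ((hop S).restrictScalars ℝ).hasFDerivAt.comp_hasDerivAt t (hψd t)
  have hηd (t : ℝ) (n : S) : HasDerivAt (fun s => η s n)
      (-Complex.I * (V n * η t n + hop S (η t) n)) t := by
    have h1 : HasDerivAt (fun s : ℝ => Complex.exp ((-s : ℝ) * V n * Complex.I))
        (Complex.exp ((-t : ℝ) * V n * Complex.I) * (-V n * Complex.I)) t := by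
      have : HasDerivAt (fun s : ℝ => ((-s : ℝ) : ℂ) * V n * Complex.I)
          (-V n * Complex.I) t := by
        have h0 := ((hasDerivAt_id t).ofReal_comp.const_mul (-(V n : ℂ) * Complex.I))
        convert! h0 using 1
        · ext s; simp; ring
        · simp
      exact this.cexp
    convert! h1.mul (coord _ _ t n (hχ t)) using 1
    have h2 : Complex.exp ((-t : ℝ) * V n * Complex.I) * Complex.exp (t * V n * Complex.I) = 1 := by
      rw [← Complex.exp_add, ← Complex.exp_zero]; congr 1; push_cast; ring
    simp only [ContinuousLinearMap.coe_restrictScalars', neg_smul, neg_apply, smul_apply,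
      ContinuousLinearMap.comp_apply, lp.coeFn_neg, lp.coeFn_smul, Pi.neg_apply, Pi.smul_apply,
      smul_eq_mul, phase_apply, hη]
    linear_combination (Complex.I * hop S (phase V (-t) (χ t)) n) * h2
  have hψ0 : ψ 0 = φ := by simp [hψ]
  have hη0 : η 0 = y := by
    ext n; simp [hη, hχ0, phase_apply]
  have main (t : ℝ) (n : S) : η t n = -Complex.I * (hop S (ψ t) n + V n * ψ t n) := by
    have hd (s : ℝ) : HasDerivAt
        (fun r => η r n + Complex.I * (hop S (ψ r) n + V n * ψ r n)) 0 s := by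
      convert! (hηd s n).add (((coord _ _ s n (hhop s)).add
        ((coord _ _ s n (hψd s)).const_mul (V n : ℂ))).const_mul Complex.I) using 1
      ring
    have := is_const_of_deriv_eq_zero (fun s => (hd s).differentiableAt) (fun s => (hd s).deriv) t 0
    simp only [hψ0, hη0, hy] at this
    have h3 : (-Complex.I • hamiltonian V φ : L2 S) n =
      -Complex.I * (hop S φ n + V n * (φ : L2 S) n) := rfl
    rw [h3] at this
    linear_combination this
  refine ⟨ψ, hψ0, fun t => ?_⟩
  have hm : ψ t ∈ (hamiltonian V).domain := mem_domain (Complex.I • η t) fun n => by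
    change Complex.I * η t n = _
    rw [main]
    linear_combination (-(hop S (ψ t) n + V n * ψ t n)) * Complex.I_mul_I
  refine ⟨hm, ?_⟩
  convert! hψd t using 1
  ext n
  exact (main t n).symm

/-- The Schrödinger equation has exactly one solution for each initial state in the domain. -/
theorem existsUnique_solution (V : S → ℝ) (φ : (hamiltonian V).domain) :
    ∃! ψ, IsSchrodingerSolution V φ ψ := by
  obtain ⟨ψ, hψ⟩ := exists_solution V φ
  exact ⟨ψ, hψ, fun χ hχ => hχ.unique hψ⟩

end

/-- The time evolution `t ↦ exp (-i t H) φ` of a state `φ` in the domain of `H`, which is the unique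
solution of the Schrödinger equation with initial state `φ`. -/
noncomputable def evolution {S : Set ℤ} (V : S → ℝ) (φ : (hamiltonian V).domain) : ℝ → L2 S :=
  (existsUnique_solution V φ).choose

theorem evolution_spec {S : Set ℤ} (V : S → ℝ) (φ : (hamiltonian V).domain) :
    IsSchrodingerSolution V φ (evolution V φ) :=
  (existsUnique_solution V φ).choose_spec.1

/-- The vector `δ_1` of the canonical basis. -/
noncomputable def deltaOne (S : Set ℤ) : L2 S :=
  ⟨fun n => if (n : ℤ) = 1 then 1 else 0, by
    refine memℓp_gen ((hasSum_sum_of_ne_finset_zero (s := Finset.preimage {1} Subtype.val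
      Subtype.val_injective.injOn) fun n hn => ?_).summable)
    have : (n : ℤ) ≠ 1 := by simpa using hn
    simp [this]⟩

theorem deltaOne_apply {S : Set ℤ} (n : S) : deltaOne S n = if (n : ℤ) = 1 then 1 else 0 := rfl

theorem deltaOne_mem_domain {S : Set ℤ} (V : S → ℝ) : deltaOne S ∈ (hamiltonian V).domain := by
  refine mem_domain (hop S (deltaOne S) + ((zeroExt V 1 : ℝ) : ℂ) • deltaOne S) fun n => ?_
  simp only [lp.coeFn_add, lp.coeFn_smul, Pi.add_apply, Pi.smul_apply, smul_eq_mul, deltaOne_apply]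
  by_cases h : (n : ℤ) = 1
  · rw [← h, zeroExt_coe]
  · simp [h]

/-- `ψ(t, n) = ⟨exp (-i t H) δ_1, δ_n⟩`. -/
noncomputable def amplitude {S : Set ℤ} (V : S → ℝ) (t : ℝ) (n : S) : ℂ :=
  evolution V ⟨deltaOne S, deltaOne_mem_domain V⟩ t n

/-- The time-averaged probability `a(n, T) = (1 / T) ∫_0^∞ exp (-2 t / T) |ψ(t, n)|² dt`. -/
noncomputable def timeAverage {S : Set ℤ} (V : S → ℝ) (n : S) (T : ℝ) : ℝ≥0∞ :=
  ENNReal.ofReal (1 / T) *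
    ∫⁻ t in Set.Ioi (0 : ℝ), ENNReal.ofReal (Real.exp (-2 * t / T) * ‖amplitude V t n‖ ^ 2)

/-- The time-averaged moment `⟨|X|^p⟩(T) = ∑_n |n|^p a(n, T)` of the position operator. -/
noncomputable def moment {S : Set ℤ} (V : S → ℝ) (p T : ℝ) : ℝ≥0∞ :=
  ∑' n : S, ENNReal.ofReal (|((n : ℤ) : ℝ)| ^ p) * timeAverage V n T

/-- The lower growth exponent `β⁻(p) = liminf_{T → ∞} log ⟨|X|^p⟩(T) / log T`. -/
noncomputable def betaMinus {S : Set ℤ} (V : S → ℝ) (p : ℝ) : EReal :=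
  liminf (fun T : ℝ => ENNReal.log (moment V p T) / ((Real.log T : ℝ) : EReal)) atTop

/-- The one-step matrix `A(n, z)`. -/
noncomputable def stepMatrix {S : Set ℤ} (V : S → ℝ) (n : ℤ) (z : ℂ) : Matrix (Fin 2) (Fin 2) ℂ :=
  !![z - ((zeroExt V n : ℝ) : ℂ), -1; 1, 0]

/-- The product `A(m + k, z) ⋯ A(m + 1, z)` of `k` one-step matrices. -/
noncomputable def stepProduct {S : Set ℤ} (V : S → ℝ) (m : ℤ) (z : ℂ) :
    ℕ → Matrix (Fin 2) (Fin 2) ℂ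
  | 0 => 1
  | k + 1 => stepMatrix V (m + (k + 1)) z * stepProduct V m z k

/-- The transfer matrix `T(n, m; z)`: it is `A(n, z) ⋯ A(m + 1, z)` for `n > m`, the identity for
`n = m`, and `T(m, n; z)⁻¹` for `n < m`. -/
noncomputable def transfer {S : Set ℤ} (V : S → ℝ) (n m : ℤ) (z : ℂ) :
    Matrix (Fin 2) (Fin 2) ℂ :=
  if m ≤ n then stepProduct V m z (n - m).toNat else (stepProduct V n z (m - n).toNat)⁻¹

/-- The power-law hypothesis: for all large `N`, the set `A N` is a nonempty Borel subset of
`[-K, K]`, and `‖T(n, m; E)‖ ≤ C N ^ α` for all `E ∈ A N` and all sites `|n|, |m| ≤ N`. The norm is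
the operator norm for the Euclidean norm on `ℂ²`. -/
def PowerLawBound {S : Set ℤ} (V : S → ℝ) (K C α : ℝ) (A : ℝ → Set ℝ) : Prop :=
  ∀ᶠ N : ℝ in atTop, (A N).Nonempty ∧ MeasurableSet (A N) ∧ A N ⊆ Set.Icc (-K) K ∧
    ∀ E ∈ A N, ∀ n m : S, |((n : ℤ) : ℝ)| ≤ N → |((m : ℤ) : ℝ)| ≤ N →
      ‖transfer V n m (E : ℂ)‖ ≤ C * N ^ α

/-- `N(T) = T ^ (1 / (1 + α))`. -/
noncomputable def scale (α T : ℝ) : ℝ := T ^ (1 / (1 + α))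

/-- The closed `1 / T`-neighborhood `B(T)` of `A(N(T))`. -/
def energyNhd (A : ℝ → Set ℝ) (α T : ℝ) : Set ℝ :=
  {E | ∃ E' ∈ A (scale α T), |E - E'| ≤ 1 / T}

end Schrodinger

/-! By Plancherel, the average `timeAverage V n T` is `1/T` times the integral over `ξ` of
`|G(n)|²`, where `G` is the Laplace transform of the amplitude at `z = -2πξ + i/T`. Integrating by
parts in time shows that `G` solves `(H - z) G = -i δ_1` (`formalH_green`), so lower bounds on the
dynamics reduce to lower bounds on solutions of a difference equation.

The source at site 1 forces `G` to be of order one near that site. Away from it `G` is carried by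
transfer matrices, whose inverses satisfy the same bounds, so `G` cannot decay faster than these
matrices permit. The bound `C N^α` at a real energy `E` survives at every complex `z` with `|z - E|
≤ 2/N^(1+α)`: over at most `2N` steps, the accumulated error in the exponent is `N^α · N^(-1-α) · N
= O(1)` (`norm_stepProduct_le`). This is why `N(T) = T^(1/(1+α))`. The perturbation `W` lives on
boundedly many sites, and crossing them costs a factor independent of `N`. Hence `|G|` is at least
of order `N^(-α)` on pairs of neighbouring sites in `[N/2, N]` or its mirror image, a mass of order
`N^(1-2α)` (`resolvent_mass`).

Integrating over the energies in `B(T)` gives the outside probability (`outside_probability_ge`),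
and the weight `(N/2)^p` gives the moments. The exponent bounds follow from two choices of `A(N)`: a
single point, with `|B(T)| = 2/T`, and, for `α = 0`, an interval of radius `N^(-1/θ)`. The key
estimates therefore assume only `α ≥ 0`. -/

namespace Schrodinger


/-! ### Plancherel's identity for integrable, square-integrable functions -/

open FourierTransform ContDiff in
/-- The Fourier transform preserves the `L²` norm of functions in `L¹ ∩ L²`. -/
theorem lintegral_enorm_fourier_sq {f : ℝ → ℂ} (h1 : Integrable f) (h2 : MemLp f 2) :
    ∫⁻ ξ, ‖𝓕 f ξ‖ₑ ^ 2 = ∫⁻ x, ‖f x‖ₑ ^ 2 := by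
  have hcont : Continuous (𝓕 f) := 
    VectorFourier.fourierIntegral_continuous Real.continuous_fourierChar continuous_inner h1
  set F : Lp ℂ 2 (volume : Measure ℝ) := 𝓕 (h2.toLp f) with hF
  have hae : (F : ℝ → ℂ) =ᵐ[volume] 𝓕 f := by
    -- The `L²` transform and the Fourier integral agree because, tested against smooth compactly
    -- supported functions, both let the transform be moved onto the test function.
    refine ae_eq_of_integral_contDiff_smul_eq ((Lp.memLp F).locallyIntegrable (by norm_num))
      hcont.locallyIntegrable fun g hg hgc => ?_
    have hg₁ : HasCompactSupport (Complex.ofRealCLM ∘ g) := hgc.comp_left rfl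
    have hg₂ : ContDiff ℝ ∞ (Complex.ofRealCLM ∘ g) := by fun_prop
    set G := hg₁.toSchwartzMap hg₂ with hG
    have e1 : ∫ x, g x • F x = Lp.toTemperedDistribution F G := by simp [hG]
    rw [e1, hF, ← Lp.fourier_toTemperedDistribution_eq, TemperedDistribution.fourier_apply,
      Lp.toTemperedDistribution_apply]
    have e2 : ∫ x, (𝓕 G) x • (h2.toLp f : ℝ → ℂ) x = ∫ x, (𝓕 G) x • f x :=
      integral_congr_ae (by filter_upwards [h2.coeFn_toLp] with x hx; rw [hx])
    have e3 : ∫ ξ, 𝓕 (G : ℝ → ℂ) ξ • f ξ = ∫ x, G x • 𝓕 f x := by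
      simpa using! VectorFourier.integral_fourierIntegral_smul_eq_flip (L := innerₗ ℝ)
        Real.continuous_fourierChar continuous_inner G.integrable h1
    rw [e2, SchwartzMap.fourier_coe, e3]
    simp [hG]
  have hn : ‖F‖ₑ = ‖h2.toLp f‖ₑ := by
    rw [← ofReal_norm, ← ofReal_norm, hF, Lp.norm_fourier_eq]
  rw [Lp.enorm_def, Lp.enorm_def, eLpNorm_congr_ae hae, eLpNorm_congr_ae h2.coeFn_toLp] at hn
  have key (g : ℝ → ℂ) : ∫⁻ x, ‖g x‖ₑ ^ 2 = eLpNorm g 2 volume ^ 2 := by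
    rw [eLpNorm_eq_lintegral_rpow_enorm_toReal (by norm_num) (by norm_num), ← ENNReal.rpow_natCast,
      ← ENNReal.rpow_mul]
    norm_num
  rw [key, key, hn]


/-! ### The Green function and Parseval's identity -/

section Green
variable {S : Set ℤ} (V : S → ℝ)

theorem hasDerivAt_amplitude (n : S) (t : ℝ) :
    HasDerivAt (fun s => amplitude V s n) (-Complex.I * formalH V (amplitude V t) n) t := by
  obtain ⟨h, hd⟩ := (evolution_spec V ⟨deltaOne S, deltaOne_mem_domain V⟩).2 t
  exact ((lp.evalCLM ℂ (fun _ : S => ℂ) 2 n).restrictScalars ℝ).hasFDerivAt.comp_hasDerivAt t hd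

theorem continuous_amplitude (n : S) : Continuous fun t => amplitude V t n :=
  continuous_iff_continuousAt.2 fun t => (hasDerivAt_amplitude V n t).continuousAt

theorem amplitude_zero (n : S) : amplitude V 0 n = if (n : ℤ) = 1 then 1 else 0 := by
  rw [amplitude, (evolution_spec V ⟨deltaOne S, deltaOne_mem_domain V⟩).1]; rfl

theorem norm_amplitude_le (n : S) (t : ℝ) : ‖amplitude V t n‖ ≤ ‖deltaOne S‖ :=
  (lp.norm_apply_le_norm (by norm_num) _ n).trans_eq
    ((evolution_spec V ⟨deltaOne S, deltaOne_mem_domain V⟩).norm_eq t)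

/-- The Laplace transform `∫₀^∞ exp (i t z) ψ(t, n) dt`, which for `Im z > 0` is
`-i ⟨(H - z)⁻¹ δ_1, δ_n⟩`. -/
noncomputable def green (z : ℂ) (n : S) : ℂ :=
  ∫ t in Set.Ioi (0 : ℝ), Complex.exp (Complex.I * z * t) * amplitude V t n

theorem norm_exp_I_mul (z : ℂ) (t : ℝ) :
    ‖Complex.exp (Complex.I * z * t)‖ = Real.exp (-z.im * t) := by
  rw [Complex.norm_exp]; simp

theorem integrableOn_green {z : ℂ} (hz : 0 < z.im) (n : S) :
    IntegrableOn (fun t : ℝ => Complex.exp (Complex.I * z * t) * amplitude V t n)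
      (Set.Ioi 0) := by
  have h := (integrableOn_exp_mul_Ioi (neg_neg_of_pos hz) 0).mul_const ‖deltaOne S‖
  refine h.mono' (Continuous.aestronglyMeasurable ?_) (ae_of_all _ fun t => ?_)
  · exact (by fun_prop : Continuous fun t : ℝ => Complex.exp (Complex.I * z * t)).mul
      (continuous_amplitude V n)
  · rw [norm_mul, norm_exp_I_mul]
    gcongr
    exact norm_amplitude_le V n t

theorem zeroExt_green {z : ℂ} (k : ℤ) : zeroExt (green V z) k =
    ∫ t in Set.Ioi (0 : ℝ), Complex.exp (Complex.I * z * t) * zeroExt (amplitude V t) k := by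
  by_cases hk : k ∈ S <;> simp [zeroExt, hk, green]

theorem integrableOn_zeroExt_green {z : ℂ} (hz : 0 < z.im) (k : ℤ) :
    IntegrableOn (fun t : ℝ => Complex.exp (Complex.I * z * t) * zeroExt (amplitude V t) k)
      (Set.Ioi 0) := by
  by_cases hk : k ∈ S
  · simpa [zeroExt, hk] using integrableOn_green V hz ⟨k, hk⟩
  · simp [zeroExt, hk]

/-- The resolvent equation `(H - z) G = -i δ_1`. -/
theorem formalH_green {z : ℂ} (hz : 0 < z.im) (n : S) :
    formalH V (green V z) n - z * green V z n = if (n : ℤ) = 1 then -Complex.I else 0 := by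
  have hi1 := integrableOn_green V hz n
  have hi2 := integrableOn_zeroExt_green V hz (n - 1)
  have hi3 := integrableOn_zeroExt_green V hz (n + 1)
  have e (t : ℝ) : Complex.exp (Complex.I * z * t) * formalH V (amplitude V t) n =
      Complex.exp (Complex.I * z * t) * zeroExt (amplitude V t) (n - 1) +
      Complex.exp (Complex.I * z * t) * zeroExt (amplitude V t) (n + 1) +
      V n * (Complex.exp (Complex.I * z * t) * amplitude V t n) := by
    rw [formalH]; ring
  have hi23 := hi2.add hi3
  have hi4 := hi1.const_mul (V n : ℂ)
  have hH : IntegrableOn (fun t : ℝ => Complex.exp (Complex.I * z * t) *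
      formalH V (amplitude V t) n) (Set.Ioi 0) := by
    simp only [e]; exact hi23.add hi4
  have hHe : ∫ t in Set.Ioi (0 : ℝ), Complex.exp (Complex.I * z * t) *
      formalH V (amplitude V t) n = formalH V (green V z) n := by
    simp only [e]
    rw [integral_add (by exact hi23) (by exact hi4), integral_add (by exact hi2) (by exact hi3),
      integral_const_mul, formalH, zeroExt_green, zeroExt_green]
    rfl
  have hd (t : ℝ) : HasDerivAt (fun t : ℝ => Complex.exp (Complex.I * z * t) * amplitude V t n)
      (Complex.I * z * (Complex.exp (Complex.I * z * t) * amplitude V t n) +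
        -Complex.I * (Complex.exp (Complex.I * z * t) * formalH V (amplitude V t) n)) t := by
    have h1 : HasDerivAt (fun s : ℝ => Complex.exp (Complex.I * z * s))
        (Complex.exp (Complex.I * z * t) * (Complex.I * z)) t := by
      have := ((hasDerivAt_id t).ofReal_comp.const_mul (Complex.I * z)).cexp
      simpa using this
    convert! h1.mul (hasDerivAt_amplitude V n t) using 1
    ring
  have hlim : Tendsto (fun t : ℝ => Complex.exp (Complex.I * z * t) * amplitude V t n)
      atTop (𝓝 0) := by
    rw [tendsto_zero_iff_norm_tendsto_zero]
    have h1 : Tendsto (fun t : ℝ => Real.exp (-z.im * t) * ‖deltaOne S‖) atTop (𝓝 0) := by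
      have : Tendsto (fun t : ℝ => -z.im * t) atTop atBot :=
        tendsto_id.const_mul_atTop_of_neg (neg_neg_of_pos hz)
      simpa using (Real.tendsto_exp_atBot.comp this).mul_const ‖deltaOne S‖
    refine squeeze_zero (fun _ => norm_nonneg _) (fun t => ?_) h1
    rw [norm_mul, norm_exp_I_mul]
    gcongr
    exact norm_amplitude_le V n t
  -- The integral of the derivative of `e^{itz} ψ(t, n)` is minus its value at `t = 0`; the initial
  -- state thus becomes the source term.
  have key := integral_Ioi_of_hasDerivAt_of_tendsto
    (hd 0).continuousAt.continuousWithinAt (fun t _ => hd t)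
    ((hi1.const_mul _).add (hH.const_mul _)) hlim
  rw [integral_add (by exact hi1.const_mul _) (by exact hH.const_mul _), integral_const_mul,
    integral_const_mul, hHe] at key
  change Complex.I * z * green V z n + _ = _ at key
  simp only [Complex.ofReal_zero, mul_zero, Complex.exp_zero, one_mul, amplitude_zero] at key
  split_ifs at key ⊢
  · linear_combination Complex.I * key - (z * green V z n - formalH V (green V z) n) *
      Complex.I_mul_I
  · linear_combination Complex.I * key - (z * green V z n - formalH V (green V z) n) *
      Complex.I_mul_I

open FourierTransform in
/-- Parseval's identity for the time averages. -/
theorem timeAverage_eq (n : S) {T : ℝ} (hT : 0 < T) :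
    timeAverage V n T = ENNReal.ofReal (1 / T) *
      ∫⁻ ξ : ℝ, ‖green V ((-2 * Real.pi * ξ : ℝ) + (1 / T : ℝ) * Complex.I) n‖ₑ ^ 2 ∧
    Continuous fun ξ : ℝ => green V ((-2 * Real.pi * ξ : ℝ) + (1 / T : ℝ) * Complex.I) n := by
  -- Squaring the damping `e^{-t/T}` gives the weight `e^{-2t/T}`, so the spectral parameter has
  -- imaginary part `1/T`; the kernel `e^{-2πitξ}` makes its real part `-2πξ`.
  set f : ℝ → ℂ := (Set.Ioi 0).indicator
    fun t => Complex.exp (Complex.I * ((1 / T : ℝ) * Complex.I) * t) * amplitude V t n with hf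
  have him : ((1 / T : ℝ) * Complex.I).im = 1 / T := by simp
  have hTi : 0 < 1 / T := by positivity
  have hint : Integrable f :=
    (integrable_indicator_iff measurableSet_Ioi).2
      (integrableOn_green V (by rwa [him]) n)
  have hn (t : ℝ) : ‖Complex.exp (Complex.I * ((1 / T : ℝ) * Complex.I) * t) * amplitude V t n‖
      = Real.exp (-(1 / T) * t) * ‖amplitude V t n‖ := by
    rw [norm_mul, norm_exp_I_mul, him]
  have hb (t : ℝ) : ‖f t‖ ≤ ‖deltaOne S‖ := by
    rw [hf]
    by_cases ht : t ∈ Set.Ioi (0 : ℝ)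
    · rw [Set.indicator_of_mem ht, hn]
      have h1 : Real.exp (-(1 / T) * t) ≤ 1 := Real.exp_le_one_iff.2 (by
        have : 0 < t := ht
        have := mul_pos hTi this
        linarith)
      calc _ ≤ 1 * ‖amplitude V t n‖ := by gcongr
        _ ≤ _ := by rw [one_mul]; exact norm_amplitude_le V n t
    · rw [Set.indicator_of_notMem ht, norm_zero]; exact norm_nonneg _
  have h2 : MemLp f 2 := by
    rw [memLp_two_iff_integrable_sq_norm hint.aestronglyMeasurable]
    refine (hint.norm.mul_const ‖deltaOne S‖).mono' (hint.aestronglyMeasurable.norm.pow 2)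
      (ae_of_all _ fun t => ?_)
    rw [Real.norm_eq_abs, abs_of_nonneg (by positivity), sq]
    gcongr
    exact hb t
  have hF (ξ : ℝ) : 𝓕 f ξ = green V ((-2 * Real.pi * ξ : ℝ) + (1 / T : ℝ) * Complex.I) n := by
    rw [Real.fourier_real_eq_integral_exp_smul, green, hf, ← integral_indicator measurableSet_Ioi]
    congr 1 with t
    by_cases ht : t ∈ Set.Ioi (0 : ℝ)
    · rw [Set.indicator_of_mem ht, Set.indicator_of_mem ht, smul_eq_mul, ← mul_assoc,
        ← Complex.exp_add]
      congr 2
      push_cast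
      ring
    · rw [Set.indicator_of_notMem ht, Set.indicator_of_notMem ht, smul_zero]
  constructor
  · simp_rw [← hF]
    rw [lintegral_enorm_fourier_sq hint h2, timeAverage, ← lintegral_indicator measurableSet_Ioi]
    congr 2 with t
    by_cases ht : t ∈ Set.Ioi (0 : ℝ)
    · rw [hf, Set.indicator_of_mem ht, Set.indicator_of_mem ht, ← ofReal_norm, hn,
        ← ENNReal.ofReal_pow (by positivity), mul_pow, ← Real.exp_nat_mul]
      congr 3
      push_cast
      ring
    · rw [hf, Set.indicator_of_notMem ht, Set.indicator_of_notMem ht]; simp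
  · have : Continuous (𝓕 f) :=
      VectorFourier.fourierIntegral_continuous Real.continuous_fourierChar continuous_inner hint
    exact this.congr hF

end Green


/-! ### Transfer matrices at nearby energies and transport of solutions -/

section Transfer

theorem norm_entry_le_l2_opNorm (P : Matrix (Fin 2) (Fin 2) ℂ) (i j : Fin 2) : ‖P i j‖ ≤ ‖P‖ := by
  have h := Matrix.l2_opNorm_mulVec P (EuclideanSpace.single j (1 : ℂ))
  rw [PiLp.norm_single, norm_one, mul_one] at h
  refine le_trans ?_ h
  refine le_trans (le_of_eq ?_) (PiLp.norm_apply_le _ i)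
  simp

variable {S : Set ℤ} (V : S → ℝ)

theorem det_stepProduct (m : ℤ) (z : ℂ) (k : ℕ) : (stepProduct V m z k).det = 1 := by
  induction k with
  | zero => simp [stepProduct]
  | succ k ih => rw [stepProduct, Matrix.det_mul, ih, stepMatrix, Matrix.det_fin_two_of]; simp

theorem stepMatrix_eq_add (n : ℤ) (z E : ℂ) :
    stepMatrix V n z = stepMatrix V n E + Matrix.diagonal ![z - E, 0] := by
  ext i j
  fin_cases i <;> fin_cases j <;> simp [stepMatrix]

/-- Duhamel's formula: the energy enters one step only through its upper left entry, so the products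
at `z` and `E` differ by a telescoping sum with one factor `diag(z - E, 0)` per site. -/
theorem stepProduct_eq_add_sum (m : ℤ) (z E : ℂ) (k : ℕ) :
    stepProduct V m z k = stepProduct V m E k + ∑ j ∈ Finset.range k,
      stepProduct V (m + j + 1) E (k - 1 - j) *
        (Matrix.diagonal ![z - E, 0] * stepProduct V m z j) := by
  induction k with
  | zero => simp [stepProduct]
  | succ k ih =>
    rw [Finset.sum_range_succ]
    have h1 : ∑ j ∈ Finset.range k, stepProduct V (m + j + 1) E (k + 1 - 1 - j) *
        (Matrix.diagonal ![z - E, 0] * stepProduct V m z j) =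
        stepMatrix V (m + (k + 1)) E * ∑ j ∈ Finset.range k,
          stepProduct V (m + j + 1) E (k - 1 - j) *
            (Matrix.diagonal ![z - E, 0] * stepProduct V m z j) := by
      rw [Finset.mul_sum]
      refine Finset.sum_congr rfl fun j hj => ?_
      have hj := Finset.mem_range.1 hj
      have e : k + 1 - 1 - j = (k - 1 - j) + 1 := by omega
      rw [e, stepProduct, ← mul_assoc, ← mul_assoc, ← mul_assoc]
      congr 4
      omega
    rw [h1, add_tsub_cancel_right, tsub_self, stepProduct, stepProduct, stepProduct, one_mul,
      stepMatrix_eq_add V _ z E, add_mul]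
    nth_rewrite 1 [ih]
    rw [mul_add, add_assoc]

/-- Inserting the claimed bound into the sum gives a geometric series that reproduces the bound
exactly. -/
theorem discrete_gronwall {x : ℕ → ℝ} {D δ : ℝ} (hD : 0 ≤ D) (hδ : 0 ≤ δ) (k : ℕ)
    (h : ∀ i ≤ k, x i ≤ D + D * δ * ∑ j ∈ Finset.range i, x j) : x k ≤ D * (1 + D * δ) ^ k := by
  induction k using Nat.strong_induction_on with
  | _ k ih =>
    have h1 : ∑ j ∈ Finset.range k, x j ≤ ∑ j ∈ Finset.range k, D * (1 + D * δ) ^ j :=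
      Finset.sum_le_sum fun j hj => ih j (Finset.mem_range.1 hj) fun i hi =>
        h i (hi.trans (Finset.mem_range.1 hj).le)
    have h2 := geom_sum_mul (1 + D * δ) k
    calc x k ≤ D + D * δ * ∑ j ∈ Finset.range k, D * (1 + D * δ) ^ j :=
          (h k le_rfl).trans (by gcongr)
      _ = _ := by
        rw [← Finset.mul_sum]
        linear_combination D * h2

/-- Power-law bounds on transfer matrices at one energy extend to nearby complex energies. -/
theorem norm_stepProduct_le (m : ℤ) (z E : ℂ) {D : ℝ} (hD : 0 ≤ D) (k : ℕ)
    (h : ∀ i j : ℕ, i + j ≤ k → ‖stepProduct V (m + i) E j‖ ≤ D) :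
    ‖stepProduct V m z k‖ ≤ D * (1 + D * ‖z - E‖) ^ k := by
  refine discrete_gronwall (x := fun k => ‖stepProduct V m z k‖) hD (norm_nonneg _) k
    fun i hi => ?_
  rw [stepProduct_eq_add_sum V m z E i]
  refine (norm_add_le _ _).trans (add_le_add ?_ ((norm_sum_le _ _).trans ?_))
  · simpa using h 0 i (by omega)
  · rw [Finset.mul_sum]
    refine Finset.sum_le_sum fun j hj => ?_
    have hj := Finset.mem_range.1 hj
    have h1 := h (j + 1) (i - 1 - j) (by omega)
    push_cast at h1
    rw [← add_assoc] at h1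
    have h2 : ‖(Matrix.diagonal ![z - E, 0] : Matrix (Fin 2) (Fin 2) ℂ)‖ ≤ ‖z - E‖ := by
      rw [Matrix.l2_opNorm_diagonal]
      refine (pi_norm_le_iff_of_nonneg (norm_nonneg _)).2 fun i => ?_
      fin_cases i <;> simp
    rw [mul_assoc]
    refine (Matrix.l2_opNorm_mul _ _).trans (mul_le_mul h1 ((Matrix.l2_opNorm_mul _ _).trans ?_)
      (norm_nonneg _) hD)
    gcongr

/-- The recurrence is required only at the sites `m < n ≤ m + k`, which allows windows ending next
to the source at site 1. -/
theorem stepProduct_transports {m : ℤ} {z : ℂ} {g : ℤ → ℂ} (k : ℕ)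
    (h : ∀ n : ℤ, m < n → n ≤ m + k →
      g (n + 1) = (z - ((zeroExt V n : ℝ) : ℂ)) * g n - g (n - 1)) :
    stepProduct V m z k 0 0 * g (m + 1) + stepProduct V m z k 0 1 * g m = g (m + k + 1) ∧
      stepProduct V m z k 1 0 * g (m + 1) + stepProduct V m z k 1 1 * g m = g (m + k) := by
  induction k with
  | zero => simp [stepProduct]
  | succ k ih =>
    obtain ⟨h0, h1⟩ := ih fun n hn hk => h n hn (by push_cast; omega)
    have h2 := h (m + k + 1) (by omega) (by push_cast; omega)
    rw [add_sub_cancel_right] at h2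
    simp only [stepProduct, Matrix.mul_apply, Fin.sum_univ_two, stepMatrix, Matrix.of_apply,
      Matrix.cons_val', Matrix.cons_val_zero, Matrix.cons_val_one, Matrix.cons_val_fin_one]
    push_cast
    rw [← add_assoc m (k : ℤ) 1]
    constructor
    · linear_combination (z - ((zeroExt V (m + k + 1) : ℝ) : ℂ)) * h0 - h1 - h2
    · linear_combination h0

/-- A solution changes over `k` sites at most by the factor `2 ‖T‖`, in both directions. -/
theorem pair_norm_le {m : ℤ} {z : ℂ} {g : ℤ → ℂ} (k : ℕ)
    (h : ∀ n : ℤ, m < n → n ≤ m + k →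
      g (n + 1) = (z - ((zeroExt V n : ℝ) : ℂ)) * g n - g (n - 1)) :
    ‖g m‖ + ‖g (m + 1)‖ ≤ 2 * ‖stepProduct V m z k‖ * (‖g (m + k)‖ + ‖g (m + k + 1)‖) ∧
    ‖g (m + k)‖ + ‖g (m + k + 1)‖ ≤ 2 * ‖stepProduct V m z k‖ * (‖g m‖ + ‖g (m + 1)‖) := by
  obtain ⟨h0, h1⟩ := stepProduct_transports V k h
  have hdet := det_stepProduct V m z k
  rw [Matrix.det_fin_two] at hdet
  set P := stepProduct V m z k
  have bound (i j i' j' : Fin 2) (a b : ℂ) :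
      ‖P i j * a + P i' j' * b‖ ≤ ‖P‖ * (‖a‖ + ‖b‖) := by
    refine (norm_add_le _ _).trans ?_
    rw [norm_mul, norm_mul, mul_add]
    gcongr <;> exact norm_entry_le_l2_opNorm _ _ _
  have bound' (i j i' j' : Fin 2) (a b : ℂ) :
      ‖P i j * a - P i' j' * b‖ ≤ ‖P‖ * (‖a‖ + ‖b‖) := by
    simpa [sub_eq_add_neg] using bound i j i' j' a (-b)
  -- Determinant one makes the inverse the adjugate, so going back costs no more than going forward.
  have e0 : g m = P 0 0 * g (m + k) - P 1 0 * g (m + k + 1) := by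
    rw [← h0, ← h1]; linear_combination -(g m) * hdet
  have e1 : g (m + 1) = P 1 1 * g (m + k + 1) - P 0 1 * g (m + k) := by
    rw [← h0, ← h1]; linear_combination -(g (m + 1)) * hdet
  constructor
  · have b0 := bound' 0 0 1 0 (g (m + k)) (g (m + k + 1))
    have b1 := bound' 1 1 0 1 (g (m + k + 1)) (g (m + k))
    rw [← e0] at b0
    rw [← e1] at b1
    linarith
  · have b0 := bound 0 0 0 1 (g (m + 1)) (g m)
    have b1 := bound 1 0 1 1 (g (m + 1)) (g m)
    rw [h0] at b0
    rw [h1] at b1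
    linarith

end Transfer


/-! ### Mass of resolvent solutions far from the origin -/

section Mass
variable {S : Set ℤ}

/-- The recurrence is symmetric in `g (n + 1)` and `g (n - 1)`, so each step costs a factor `R` in
either direction. This crude bound serves on the fixed stretch near the origin that contains the
support of `W`. -/
theorem chain_norm_le {m : ℤ} {w : ℤ → ℂ} {g : ℤ → ℂ} {R : ℝ} (k : ℕ)
    (h : ∀ n : ℤ, m < n → n ≤ m + k → 1 + ‖w n‖ ≤ R ∧ g (n + 1) = w n * g n - g (n - 1)) :
    ‖g m‖ + ‖g (m + 1)‖ ≤ R ^ k * (‖g (m + k)‖ + ‖g (m + k + 1)‖) ∧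
    ‖g (m + k)‖ + ‖g (m + k + 1)‖ ≤ R ^ k * (‖g m‖ + ‖g (m + 1)‖) := by
  induction k with
  | zero => simp
  | succ k ih =>
    obtain ⟨h0, h1⟩ := ih fun n hn hk => h n hn (by push_cast; omega)
    obtain ⟨hR, h2⟩ := h (m + k + 1) (by omega) (by push_cast; omega)
    rw [add_sub_cancel_right] at h2
    push_cast
    rw [← add_assoc m (k : ℤ) 1]
    set a := g (m + k)
    set b := g (m + k + 1)
    set c := g (m + k + 1 + 1)
    have hw := norm_nonneg (w (m + k + 1))
    have hR0 : 0 ≤ R := by linarith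
    have hb : ‖w (m + k + 1) * b‖ ≤ (R - 1) * ‖b‖ := by
      rw [norm_mul]; gcongr; linarith
    have hc : ‖c‖ ≤ (R - 1) * ‖b‖ + ‖a‖ := by
      rw [h2]; exact (norm_sub_le _ _).trans (by linarith)
    have ha : ‖a‖ ≤ (R - 1) * ‖b‖ + ‖c‖ := by
      have : a = w (m + k + 1) * b - c := by rw [h2]; ring
      rw [this]; exact (norm_sub_le _ _).trans (by linarith)
    have hRa : ‖a‖ ≤ R * ‖a‖ := le_mul_of_one_le_left (norm_nonneg _) (by linarith)
    have hRc : ‖c‖ ≤ R * ‖c‖ := le_mul_of_one_le_left (norm_nonneg _) (by linarith)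
    constructor
    · refine h0.trans ?_
      rw [pow_succ, mul_assoc]
      gcongr
      linarith
    · calc ‖b‖ + ‖c‖ ≤ R * (‖a‖ + ‖b‖) := by linarith
        _ ≤ R * (R ^ k * (‖g m‖ + ‖g (m + 1)‖)) := by gcongr
        _ = _ := by ring

/-- It is unknown which member of each pair is large. By `(x + y)² ≤ 2(x² + y²)`, the sums over
first and over second members total at least `M σ² / 2`, so one of them is at least half of that. -/
theorem ofReal_le_tsum_sq {X : Type} (u : X → ℂ) {ι : ℕ → X} (hι : Function.Injective ι) (M : ℕ)
    {σ : ℝ} (hσ : 0 ≤ σ) (h : ∀ j < M, σ ≤ ‖u (ι j)‖ + ‖u (ι (j + 1))‖) :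
    ENNReal.ofReal (M * σ ^ 2 / 4) ≤ ∑' x, ENNReal.ofReal (‖u x‖ ^ 2) := by
  have key (κ : ℕ → X) (hκ : Function.Injective κ) :
      ENNReal.ofReal (∑ j ∈ Finset.range M, ‖u (κ j)‖ ^ 2) ≤
        ∑' x, ENNReal.ofReal (‖u x‖ ^ 2) := by
    rw [ENNReal.ofReal_sum_of_nonneg fun _ _ => by positivity]
    exact (ENNReal.sum_le_tsum _).trans
      (ENNReal.tsum_comp_le_tsum_of_injective hκ fun x => ENNReal.ofReal (‖u x‖ ^ 2))
  have h1 := key ι hι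
  have h2 := key (fun j => ι (j + 1)) (hι.comp (add_left_injective 1))
  have h3 : M * σ ^ 2 / 2 ≤ ∑ j ∈ Finset.range M, ‖u (ι j)‖ ^ 2 +
      ∑ j ∈ Finset.range M, ‖u (ι (j + 1))‖ ^ 2 := by
    rw [← Finset.sum_add_distrib]
    calc _ = ∑ j ∈ Finset.range M, σ ^ 2 / 2 := by simp; ring
      _ ≤ _ := Finset.sum_le_sum fun j hj => by
        have := pow_le_pow_left₀ hσ (h j (Finset.mem_range.1 hj)) 2
        nlinarith [sq_nonneg (‖u (ι j)‖ - ‖u (ι (j + 1))‖)]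
  rcases le_total (∑ j ∈ Finset.range M, ‖u (ι j)‖ ^ 2)
    (∑ j ∈ Finset.range M, ‖u (ι (j + 1))‖ ^ 2) with h4 | h4
  · exact (ENNReal.ofReal_le_ofReal (by linarith)).trans h2
  · exact (ENNReal.ofReal_le_ofReal (by linarith)).trans h1

/-- With `k ≤ 2N`, the Gronwall exponent is at most `C N^α · 2 N^(-1-α) · 2N = 4C`. -/
theorem norm_stepProduct_le_of_transfer {V : S → ℝ} {E : ℝ} {z : ℂ} {C α N : ℝ} (hC : 0 < C)
    (hN : 0 < N)
    (hT : ∀ n m : S, (m : ℤ) ≤ n → |((n : ℤ) : ℝ)| ≤ N → |((m : ℤ) : ℝ)| ≤ N →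
      ‖transfer V n m (E : ℂ)‖ ≤ C * N ^ α)
    (hz : ‖z - E‖ ≤ 2 / N ^ (1 + α)) (m : ℤ) (k : ℕ)
    (hm : ∀ i : ℤ, m ≤ i → i ≤ m + k → i ∈ S) (hl : -N ≤ m) (hr : ((m + k : ℤ) : ℝ) ≤ N) :
    ‖stepProduct V m z k‖ ≤ C * Real.exp (4 * C) * N ^ α := by
  have hNa : 0 < N ^ α := Real.rpow_pos_of_pos hN α
  have habs (i : ℤ) (h1 : m ≤ i) (h2 : i ≤ m + k) : |(i : ℝ)| ≤ N := by
    have h1 : (m : ℝ) ≤ i := by exact_mod_cast h1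
    have h2 : (i : ℝ) ≤ (m + k : ℤ) := by exact_mod_cast h2
    rw [abs_le]; constructor <;> linarith
  have h1 := norm_stepProduct_le V m z E (D := C * N ^ α) (by positivity) k fun i j hij => by
    have := hT ⟨m + i + j, hm _ (by omega) (by omega)⟩ ⟨m + i, hm _ (by omega) (by omega)⟩
      (by simp) (habs (m + i + j) (by omega) (by omega))
      (habs (m + i) (by omega) (by omega))
    rw [transfer, if_pos (by simp)] at this
    simpa using this
  refine h1.trans ?_
  have hk : (k : ℝ) ≤ 2 * N := by push_cast at hr; linarith
  have h2 : C * N ^ α * ‖z - E‖ * k ≤ 4 * C := by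
    calc C * N ^ α * ‖z - E‖ * k ≤ C * N ^ α * (2 / N ^ (1 + α)) * (2 * N) := by gcongr
      _ = 4 * C := by
        rw [Real.rpow_add hN, Real.rpow_one]; field_simp; ring
  calc _ ≤ C * N ^ α * Real.exp (C * N ^ α * ‖z - E‖) ^ k := by
        gcongr
        rw [add_comm]; exact Real.add_one_le_exp _
    _ = C * N ^ α * Real.exp (C * N ^ α * ‖z - E‖ * k) := by
        rw [← Real.exp_nat_mul, mul_comm (k : ℝ)]
    _ ≤ C * N ^ α * Real.exp (4 * C) := by gcongr
    _ = _ := by ring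

/-- Solutions of the resolvent equation with source `δ_1` have much mass far from the origin. -/
theorem resolvent_mass (hS : S = Set.univ ∨ S = Set.Ici 1) (V₀ W : S → ℝ)
    (hW : (Function.support W).Finite) {K C α : ℝ} (hK : 0 ≤ K) (hC : 0 < C) (hα : 0 ≤ α) :
    ∃ c : ℝ, 0 < c ∧ ∃ N₀ : ℝ, 1 ≤ N₀ ∧ ∀ N, N₀ ≤ N → ∀ E : ℝ, |E| ≤ K →
      (∀ n m : S, (m : ℤ) ≤ n → |((n : ℤ) : ℝ)| ≤ N → |((m : ℤ) : ℝ)| ≤ N →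
        ‖transfer V₀ n m (E : ℂ)‖ ≤ C * N ^ α) →
      ∀ z : ℂ, ‖z - E‖ ≤ 2 / N ^ (1 + α) → ∀ u : S → ℂ,
      (∀ n : S, formalH (V₀ + W) u n - z * u n = if (n : ℤ) = 1 then -Complex.I else 0) →
      ENNReal.ofReal (c * N ^ (1 - 2 * α)) ≤
        ∑' n : {n : S // N / 2 ≤ |((n : ℤ) : ℝ)|}, ENNReal.ofReal (‖u n.1‖ ^ 2) := by
  obtain ⟨L, hL⟩ : ∃ L : ℕ, ∀ n : S, W n ≠ 0 → |(n : ℤ)| < L := by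
    obtain ⟨b, hb⟩ := (hW.image fun n : S => (n : ℤ).natAbs).bddAbove
    refine ⟨b + 1, fun n hn => ?_⟩
    have : (n : ℤ).natAbs ≤ b := hb ⟨n, hn, rfl⟩
    rw [Int.abs_eq_natAbs]
    omega
  -- `3 + K` is `1` plus the bound `K + 2` on `‖z‖`, so `R` dominates `1 + ‖z - V n‖` near the
  -- origin.
  obtain ⟨R, hR⟩ : ∃ R : ℝ, ∀ n : ℤ, |n| ≤ L + 1 → 3 + K + |zeroExt (V₀ + W) n| ≤ R := by
    obtain ⟨b, hb⟩ := ((Set.finite_Icc (-(L + 1) : ℤ) (L + 1)).image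
      fun n : ℤ => 3 + K + |zeroExt (V₀ + W) n|).bddAbove
    exact ⟨b, fun n hn => hb ⟨n, abs_le.1 hn, rfl⟩⟩
  have hR1 : 1 ≤ R := by
    have := hR 0 (by simp; omega)
    have := abs_nonneg (zeroExt (V₀ + W) 0)
    linarith
  -- The size `1/(2R)` near the source, divided by the loss `R^L` across the support of `W` and the
  -- `N`-independent part of the transfer loss.
  set κ : ℝ := 1 / (2 * R) / (R ^ L * (2 * (C * Real.exp (4 * C)))) with hκ
  have hR0 : 0 < R := by linarith
  have hκ0 : 0 < κ := by positivity
  -- `32 = 8 · 4`: at least `N/8` pairs, and the `1/4` of `ofReal_le_tsum_sq`. The threshold `2L +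
  -- 8` puts `N/2` beyond the support of `W` and makes `⌊N/4⌋ ≥ N/8`.
  refine ⟨κ ^ 2 / 32, by positivity, 2 * L + 8, by linarith [(Nat.cast_nonneg L : (0 : ℝ) ≤ L)],
    fun N hN E hE hT z hz u hu => ?_⟩
  have hL0 := (Nat.cast_nonneg L : (0 : ℝ) ≤ L)
  have hN0 : 0 < N := by linarith
  have hNa : 0 < N ^ α := Real.rpow_pos_of_pos hN0 α
  have hzK : ‖z‖ ≤ K + 2 := by
    have h1 : (1 : ℝ) ≤ N ^ (1 + α) := Real.one_le_rpow (by linarith) (by linarith)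
    have h2 : 2 / N ^ (1 + α) ≤ 2 := div_le_self (by norm_num) h1
    calc ‖z‖ = ‖(E : ℂ) + (z - E)‖ := by congr 1; ring
      _ ≤ ‖(E : ℂ)‖ + ‖z - E‖ := norm_add_le _ _
      _ ≤ _ := by rw [Complex.norm_real, Real.norm_eq_abs]; linarith
  set g : ℤ → ℂ := zeroExt u with hg
  have hgS (n : S) : u n = g n := (zeroExt_coe u n).symm
  have hwR (n : ℤ) (hn : |n| ≤ L + 1) : 1 + ‖z - ((zeroExt (V₀ + W) n : ℝ) : ℂ)‖ ≤ R := by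
    have h1 := hR n hn
    have h2 := norm_sub_le z ((zeroExt (V₀ + W) n : ℝ) : ℂ)
    rw [Complex.norm_real, Real.norm_eq_abs] at h2
    linarith
  have hrec (n : ℤ) (hn : n ∈ S) (hn1 : n ≠ 1) :
      g (n + 1) = (z - ((zeroExt (V₀ + W) n : ℝ) : ℂ)) * g n - g (n - 1) := by
    have h1 := hu ⟨n, hn⟩
    rw [if_neg hn1, formalH, hgS, ← zeroExt_coe (V₀ + W)] at h1
    linear_combination h1
  have hVW (n : ℤ) (hn : (L : ℤ) ≤ |n|) : zeroExt (V₀ + W) n = zeroExt V₀ n := by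
    by_cases h : n ∈ S
    · have : W ⟨n, h⟩ = 0 := by
        by_contra h0
        exact absurd (hL _ h0) (not_lt.2 hn)
      simp [zeroExt, h, this]
    · simp [zeroExt, h]
  have h1S : (1 : ℤ) ∈ S := by rcases hS with rfl | rfl <;> simp
  have hpS (n : ℤ) (hn : 1 ≤ n) : n ∈ S := by rcases hS with rfl | rfl <;> simp [hn]
  have hone : 1 ≤ ‖g 0‖ + ‖g 2‖ + (R - 1) * ‖g 1‖ := by
    have h1 := hu ⟨1, h1S⟩
    rw [if_pos rfl, formalH, hgS, ← zeroExt_coe (V₀ + W)] at h1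
    have h2 : -Complex.I = g 0 + g 2 - (z - ((zeroExt (V₀ + W) 1 : ℝ) : ℂ)) * g 1 := by
      simp only [sub_self, Int.reduceAdd] at h1
      linear_combination -h1
    have h3 : (1 : ℝ) = ‖g 0 + g 2 - (z - ((zeroExt (V₀ + W) 1 : ℝ) : ℂ)) * g 1‖ := by
      rw [← h2]; simp
    rw [h3]
    refine (norm_sub_le _ _).trans (add_le_add (norm_add_le _ _) ?_)
    rw [norm_mul]
    gcongr
    linarith [hwR 1 (by simp)]
  -- If both pairs around site 1 were small, the equation at that site could not produce a source of
  -- modulus one. On the half line `g 0 = 0`, which leaves only the right-hand pair.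
  have hdich : 1 / (2 * R) ≤ ‖g 1‖ + ‖g (1 + 1)‖ ∨
      (S = Set.univ ∧ 1 / (2 * R) ≤ ‖g 0‖ + ‖g (0 + 1)‖) := by
    have e1 : (1 + 1 : ℤ) = 2 := rfl
    have e2 : (0 + 1 : ℤ) = 1 := rfl
    rw [e1, e2]
    by_contra! hcon
    obtain ⟨c1, c2⟩ := hcon
    have hhalf : R * (1 / (2 * R)) = 1 / 2 := by field_simp
    have c1' := mul_lt_mul_of_pos_left c1 hR0
    rw [hhalf] at c1'
    have hg2 : ‖g 2‖ ≤ R * ‖g 2‖ := le_mul_of_one_le_left (norm_nonneg _) hR1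
    have hg1 := norm_nonneg (g 1)
    rcases hS with hS | hS
    · have c2' := mul_lt_mul_of_pos_left (c2 hS) hR0
      rw [hhalf] at c2'
      have hg0 : ‖g 0‖ ≤ R * ‖g 0‖ := le_mul_of_one_le_left (norm_nonneg _) hR1
      nlinarith
    · have : g 0 = 0 := zeroExt_of_notMem u (by rw [hS]; simp)
      rw [this, norm_zero] at hone
      nlinarith
  set σ : ℝ := κ / N ^ α with hσ
  have hσ0 : 0 ≤ σ := by positivity
  have hfinal (s : ℝ) (hs : 1 / (2 * R) ≤ R ^ L * (2 * (C * Real.exp (4 * C) * N ^ α) * s)) :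
      σ ≤ s := by
    rw [hσ, hκ, div_div, div_le_iff₀ (by positivity)]
    refine hs.trans_eq ?_
    ring
  set M : ℕ := ⌊N / 4⌋₊ with hM
  set a : ℕ := ⌈N / 2⌉₊ with ha
  have hM1 : N / 8 ≤ M := by
    have := Nat.lt_floor_add_one (N / 4)
    rw [← hM] at this; linarith
  have hM2 : (M : ℝ) ≤ N / 4 := Nat.floor_le (by linarith)
  have ha1 : N / 2 ≤ a := Nat.le_ceil _
  have ha2 : (a : ℝ) < N / 2 + 1 := Nat.ceil_lt_add_one (by linarith)
  have haL : L + 1 ≤ a := by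
    have : ((L + 1 : ℕ) : ℝ) ≤ a := by push_cast; linarith
    exact_mod_cast this
  have hconst : κ ^ 2 / 32 * N ^ (1 - 2 * α) ≤ M * σ ^ 2 / 4 := by
    have e : N ^ (1 - 2 * α) = N / (N ^ α) ^ 2 := by
      rw [Real.rpow_sub hN0, Real.rpow_one, mul_comm 2 α, Real.rpow_mul hN0.le]
      norm_num
    rw [e, hσ, div_pow κ]
    calc _ = (N / 8) * (κ ^ 2 / (N ^ α) ^ 2) / 4 := by ring
      _ ≤ _ := by gcongr
  refine (ENNReal.ofReal_le_ofReal hconst).trans ?_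
  rcases hdich with hd | ⟨hSu, hd⟩
  -- Rightward case: cross from the pair at `1` to the pair at `1 + L` crudely, then to `a + j` with
  -- the transfer matrices of `V₀`. The recurrence is used only at sites beyond 1.
  · set ι : ℕ → {n : S // N / 2 ≤ |((n : ℤ) : ℝ)|} := fun j =>
      ⟨⟨a + j, hpS _ (by omega)⟩, by
        push_cast
        exact (ha1.trans (by linarith [(Nat.cast_nonneg j : (0 : ℝ) ≤ j)])).trans
          (le_abs_self _)⟩ with hι
    refine ofReal_le_tsum_sq (fun n : {n : S // N / 2 ≤ |((n : ℤ) : ℝ)|} => u n.1) (ι := ι) ?_ M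
      hσ0 fun j hj => hfinal _ ?_
    · intro i j hij
      simpa [hι] using hij
    · have hjM : (j : ℝ) + 1 ≤ M := by exact_mod_cast hj
      obtain ⟨k, hk⟩ : ∃ k : ℕ, (a : ℤ) + j = 1 + L + k := ⟨a + j - (1 + L), by omega⟩
      have c1 := (chain_norm_le (m := 1) (w := fun n => z - ((zeroExt (V₀ + W) n : ℝ) : ℂ))
        (g := g) (R := R) L fun n h1 h2 => ⟨hwR n (by rw [abs_le]; omega),
          hrec n (hpS n (by omega)) (by omega)⟩).1
      have c2 := (pair_norm_le V₀ (m := 1 + L) (z := z) (g := g) k fun n h1 h2 => by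
        rw [← hVW n ((by omega : (L : ℤ) ≤ n).trans (le_abs_self n))]
        exact hrec n (hpS n (by omega)) (by omega)).1
      have c3 := norm_stepProduct_le_of_transfer hC hN0 hT hz (1 + L) k
        (fun i h1 h2 => hpS i (by omega)) (by push_cast; linarith)
        (by rw [← hk]; push_cast; linarith)
      rw [← hk] at c2
      refine hd.trans (c1.trans ?_)
      gcongr
      refine c2.trans ?_
      simp only [hgS, hι]
      push_cast
      rw [← add_assoc]
      gcongr
  · have huS (n : ℤ) : n ∈ S := by rw [hSu]; trivial
    -- Leftward case: the second halves of the transport bounds control the pair at `0` by the pair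
    -- at `-L`, and that by the pair at `-(a + j + 1)`, whose right member is `-(a + j)`.
    set ι : ℕ → {n : S // N / 2 ≤ |((n : ℤ) : ℝ)|} := fun j =>
      ⟨⟨-(a + j), huS _⟩, by
        push_cast
        rw [abs_neg]
        exact (ha1.trans (by linarith [(Nat.cast_nonneg j : (0 : ℝ) ≤ j)])).trans
          (le_abs_self _)⟩ with hι
    refine ofReal_le_tsum_sq (fun n : {n : S // N / 2 ≤ |((n : ℤ) : ℝ)|} => u n.1) (ι := ι) ?_ M
      hσ0 fun j hj => hfinal _ ?_
    · intro i j hij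
      simpa [hι] using hij
    · have hjM : (j : ℝ) + 1 ≤ M := by exact_mod_cast hj
      obtain ⟨k, hk⟩ : ∃ k : ℕ, -((a : ℤ) + (j + 1)) + k = -L := ⟨a + (j + 1) - L, by omega⟩
      have c1 := (chain_norm_le (m := -L) (w := fun n => z - ((zeroExt (V₀ + W) n : ℝ) : ℂ))
        (g := g) (R := R) L fun n h1 h2 => ⟨hwR n (by rw [abs_le]; omega),
          hrec n (huS n) (by omega)⟩).2
      have c2 := (pair_norm_le V₀ (m := -((a : ℤ) + (j + 1))) (z := z) (g := g) k fun n h1 h2 => by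
        rw [← hVW n ((by omega : (L : ℤ) ≤ -n).trans (neg_le_abs n))]
        exact hrec n (huS n) (by omega)).2
      have c3 := norm_stepProduct_le_of_transfer hC hN0 hT hz (-((a : ℤ) + (j + 1))) k
        (fun i h1 h2 => huS i) (by push_cast; linarith)
        (by rw [hk]; push_cast; linarith)
      rw [hk] at c2
      rw [neg_add_cancel] at c1
      refine hd.trans (c1.trans ?_)
      gcongr
      refine c2.trans ?_
      simp only [hgS, hι]
      push_cast
      have e : (-((a : ℤ) + (j + 1)) + 1) = -(a + j) := by ring
      rw [e, add_comm ‖g (-((a : ℤ) + (j + 1)))‖]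
      gcongr

end Mass


/-! ### Cocycle relation for transfer matrices -/

section Cocycle
variable {S : Set ℤ} (V : S → ℝ)

/-- Cayley–Hamilton gives `P⁻¹ = tr P - P`, and the trace is at most `2‖P‖`. -/
theorem norm_inv_le_of_det_eq_one {P : Matrix (Fin 2) (Fin 2) ℂ} (hP : P.det = 1) :
    ‖P⁻¹‖ ≤ 3 * ‖P‖ := by
  have h1 : P⁻¹ = Matrix.diagonal (fun _ => P 0 0 + P 1 1) - P := by
    rw [Matrix.inv_def, hP, Ring.inverse_one, one_smul, Matrix.adjugate_fin_two]
    ext i j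
    fin_cases i <;> fin_cases j <;> simp
  rw [h1]
  refine (norm_sub_le _ _).trans ?_
  rw [Matrix.l2_opNorm_diagonal, pi_norm_const]
  have h2 := norm_add_le (P 0 0) (P 1 1)
  have h3 := norm_entry_le_l2_opNorm P 0 0
  have h4 := norm_entry_le_l2_opNorm P 1 1
  linarith

theorem stepProduct_succ' (m : ℤ) (z : ℂ) (k : ℕ) :
    stepProduct V m z (k + 1) = stepProduct V (m + 1) z k * stepMatrix V (m + 1) z := by
  induction k with
  | zero => simp [stepProduct]
  | succ k ih =>
    rw [stepProduct, ih, stepProduct, mul_assoc]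
    congr 2
    push_cast
    ring

theorem det_transfer (n m : ℤ) (z : ℂ) : (transfer V n m z).det = 1 := by
  rw [transfer]
  split_ifs
  · exact det_stepProduct V _ _ _
  · rw [Matrix.det_nonsing_inv, det_stepProduct, Ring.inverse_one]

theorem transfer_succ_one (n : ℤ) (z : ℂ) :
    transfer V (n + 1) 1 z = stepMatrix V (n + 1) z * transfer V n 1 z := by
  rcases le_or_gt 1 n with h | h
  · obtain ⟨k, hk⟩ : ∃ k : ℕ, n = 1 + k := ⟨(n - 1).toNat, by omega⟩
    subst hk
    rw [transfer, transfer, if_pos (by omega), if_pos (by omega)]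
    have e1 : ((1 + k + 1 : ℤ) - 1).toNat = k + 1 := by omega
    have e2 : ((1 + k : ℤ) - 1).toNat = k := by omega
    rw [e1, e2, stepProduct, add_assoc]
  · obtain ⟨k, hk⟩ : ∃ k : ℕ, n = -k := ⟨(-n).toNat, by omega⟩
    have e1 : transfer V (n + 1) 1 z = (stepProduct V (n + 1) z k)⁻¹ := by
      rw [transfer]
      -- At `n = 0` the left-hand side is already in the other branch of the definition; both
      -- branches give the identity there.
      split_ifs with h1
      · have hk0 : k = 0 := by omega
        have hn0 : n = 0 := by omega
        subst hk0 hn0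
        simp [stepProduct]
      · congr 2; omega
    have e2 : transfer V n 1 z = (stepProduct V n z (k + 1))⁻¹ := by
      rw [transfer, if_neg (by omega)]
      congr 2; omega
    have hdet : IsUnit (stepMatrix V (n + 1) z).det := by
      rw [stepMatrix, Matrix.det_fin_two_of]; simp
    rw [e1, e2, stepProduct_succ', Matrix.mul_inv_rev, Matrix.mul_nonsing_inv_cancel_left _ _ hdet]

theorem isUnit_det_transfer (n m : ℤ) (z : ℂ) : IsUnit (transfer V n m z).det := by
  rw [det_transfer]; exact isUnit_one

theorem transfer_eq_mul_inv (n m : ℤ) (z : ℂ) :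
    transfer V n m z = transfer V n 1 z * (transfer V m 1 z)⁻¹ := by
  have key (m : ℤ) (k : ℕ) :
      stepProduct V m z k * transfer V m 1 z = transfer V (m + k) 1 z := by
    induction k with
    | zero => simp [stepProduct]
    | succ k ih =>
      rw [stepProduct, mul_assoc, ih, Nat.cast_succ, ← add_assoc, transfer_succ_one]
  have hstep (n m : ℤ) (hmn : m ≤ n) :
      stepProduct V m z (n - m).toNat = transfer V n 1 z * (transfer V m 1 z)⁻¹ := by
    have h1 := key m (n - m).toNat
    have e : m + ((n - m).toNat : ℤ) = n := by omega
    rw [e] at h1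
    rw [← h1, Matrix.mul_nonsing_inv_cancel_right _ _ (isUnit_det_transfer V m 1 z)]
  nth_rewrite 1 [transfer]
  split_ifs with h
  · exact hstep n m h
  · rw [hstep m n (by omega), Matrix.mul_inv_rev,
      Matrix.nonsing_inv_nonsing_inv _ (isUnit_det_transfer V n 1 z)]

/-- Needed where only transfer matrices based at site 1 are controlled. -/
theorem norm_transfer_le (n m : ℤ) (z : ℂ) :
    ‖transfer V n m z‖ ≤ ‖transfer V n 1 z‖ * (3 * ‖transfer V m 1 z‖) := by
  rw [transfer_eq_mul_inv]
  refine (Matrix.l2_opNorm_mul _ _).trans ?_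
  gcongr
  exact norm_inv_le_of_det_eq_one (det_transfer V m 1 z)

/-- Supplies the site 0, which the bounded-transfer hypothesis near one energy leaves out. -/
theorem norm_transfer_zero_one_le (z : ℂ) :
    ‖transfer V 0 1 z‖ ≤ 3 * (‖stepMatrix V 1 0‖ + ‖z‖) := by
  have h1 : transfer V 0 1 z = (stepMatrix V 1 z)⁻¹ := by
    rw [transfer, if_neg (by norm_num)]
    simp [stepProduct]
  rw [h1]
  refine (norm_inv_le_of_det_eq_one (by rw [stepMatrix, Matrix.det_fin_two_of]; simp)).trans ?_
  gcongr
  rw [stepMatrix_eq_add V 1 z 0]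
  refine (norm_add_le _ _).trans ?_
  gcongr
  rw [Matrix.l2_opNorm_diagonal]
  refine (pi_norm_le_iff_of_nonneg (norm_nonneg _)).2 fun i => ?_
  fin_cases i <;> simp

end Cocycle

/-! ### From resolvent mass to probabilities, moments and growth exponents -/

section Dynamics
variable {S : Set ℤ}

theorem scale_rpow {α T : ℝ} (hα : 0 ≤ α) (hT : 0 ≤ T) : scale α T ^ (1 + α) = T := by
  rw [scale, ← Real.rpow_mul hT, one_div_mul_cancel (by positivity), Real.rpow_one]

/-- Lower bound on the outside probabilities, uniform over the sets `A` of energies with a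
power-law bound on the transfer matrices. -/
theorem outside_probability_ge (hS : S = Set.univ ∨ S = Set.Ici 1) (V₀ W : S → ℝ)
    (hW : (Function.support W).Finite) {K C α : ℝ} (hK : 0 ≤ K) (hC : 0 < C) (hα : 0 ≤ α) :
    ∃ c : ℝ, 0 < c ∧ ∃ T₀ : ℝ, 1 < T₀ ∧ ∀ T, T₀ ≤ T → ∀ A : Set ℝ,
      (∀ E ∈ A, |E| ≤ K ∧ ∀ n m : S, (m : ℤ) ≤ n → |((n : ℤ) : ℝ)| ≤ scale α T →
        |((m : ℤ) : ℝ)| ≤ scale α T → ‖transfer V₀ n m (E : ℂ)‖ ≤ C * scale α T ^ α) →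
      ENNReal.ofReal (c / T * scale α T ^ (1 - 2 * α)) *
          volume {E : ℝ | ∃ E' ∈ A, |E - E'| ≤ 1 / T} ≤
        ∑' n : {n : S // scale α T / 2 ≤ |((n : ℤ) : ℝ)|}, timeAverage (V₀ + W) n.1 T := by
  obtain ⟨c, hc, N₀, hN₀, h⟩ := resolvent_mass hS V₀ W hW hK hC hα
  have hN₀' : 0 < N₀ ^ (1 + α) := Real.rpow_pos_of_pos (by linarith) _
  refine ⟨c / (2 * Real.pi), by positivity, N₀ ^ (1 + α) + 1, by linarith, fun T hT A hA => ?_⟩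
  have hT0 : 0 < T := by linarith
  have hN : N₀ ≤ scale α T := by
    refine (Real.rpow_le_rpow_iff (z := 1 + α) (by linarith) (Real.rpow_nonneg hT0.le _)
      (by linarith)).1 ?_
    have := scale_rpow (α := α) hα hT0.le
    rw [scale] at this
    linarith
  set N := scale α T with hNdef
  have hN0 : 0 < N := by linarith
  set B := {E : ℝ | ∃ E' ∈ A, |E - E'| ≤ 1 / T} with hB
  set ζ : ℝ → ℂ := fun ξ => (-2 * Real.pi * ξ : ℝ) + (1 / T : ℝ) * Complex.I with hζ
  set F : ℝ → ℝ≥0∞ := fun ξ => ∑' n : {n : S // N / 2 ≤ |((n : ℤ) : ℝ)|},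
    ‖green (V₀ + W) (ζ ξ) n.1‖ₑ ^ 2 with hF
  have hcont (n : S) : Continuous fun ξ => green (V₀ + W) (ζ ξ) n :=
    (timeAverage_eq (V₀ + W) n hT0).2
  have hmeas (n : S) : Measurable fun ξ => ‖green (V₀ + W) (ζ ξ) n‖ₑ ^ 2 :=
    ((ENNReal.continuous_pow 2).comp (hcont n).enorm).measurable
  have hFm : Measurable F :=
    Measurable.tsum (f := fun (n : {n : S // N / 2 ≤ |((n : ℤ) : ℝ)|}) ξ =>
      ‖green (V₀ + W) (ζ ξ) n.1‖ₑ ^ 2) fun n => hmeas n.1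
  have hsum : ∑' n : {n : S // N / 2 ≤ |((n : ℤ) : ℝ)|}, timeAverage (V₀ + W) n.1 T =
      ENNReal.ofReal (1 / T) * ∫⁻ ξ, F ξ := by
    have h1 : ∫⁻ ξ, F ξ = ∑' n : {n : S // N / 2 ≤ |((n : ℤ) : ℝ)|},
        ∫⁻ ξ, ‖green (V₀ + W) (ζ ξ) n.1‖ₑ ^ 2 :=
      lintegral_tsum (f := fun (n : {n : S // N / 2 ≤ |((n : ℤ) : ℝ)|}) ξ =>
        ‖green (V₀ + W) (ζ ξ) n.1‖ₑ ^ 2) fun n => (hmeas n.1).aemeasurable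
    rw [h1, ← ENNReal.tsum_mul_left]
    exact tsum_congr fun n => (timeAverage_eq (V₀ + W) n.1 hT0).1
  -- Energies in `B` are within `1/T` of `A`, and the imaginary part adds another `1/T`: hence the
  -- radius `2/T = 2/N^(1+α)`.
  have hlow : (fun ξ : ℝ => -2 * Real.pi * ξ) ⁻¹' B ⊆
      {ξ | ENNReal.ofReal (c * N ^ (1 - 2 * α)) ≤ F ξ} := by
    rintro ξ ⟨E', hE', hd⟩
    obtain ⟨h1, h2⟩ := hA E' hE'
    have hz : ‖ζ ξ - E'‖ ≤ 2 / N ^ (1 + α) := by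
      rw [hNdef, scale_rpow hα hT0.le]
      calc ‖ζ ξ - E'‖ = ‖((-2 * Real.pi * ξ - E' : ℝ) : ℂ) + (1 / T : ℝ) * Complex.I‖ := by
            rw [hζ]; congr 1; push_cast; ring
        _ ≤ ‖((-2 * Real.pi * ξ - E' : ℝ) : ℂ)‖ + ‖((1 / T : ℝ) : ℂ) * Complex.I‖ := norm_add_le _ _
        _ = |-2 * Real.pi * ξ - E'| + 1 / T := by
            rw [norm_mul, Complex.norm_I, mul_one, Complex.norm_real, Complex.norm_real,
              Real.norm_eq_abs, Real.norm_eq_abs, abs_of_pos (by positivity : 0 < 1 / T)]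
        _ ≤ 1 / T + 1 / T := by gcongr
        _ = 2 / T := by ring
    have him : 0 < (ζ ξ).im := by simp [hζ, hT0]
    refine (h N hN E' h1 h2 (ζ ξ) hz _ (formalH_green (V₀ + W) him)).trans_eq ?_
    refine tsum_congr fun n => ?_
    rw [← ofReal_norm, ENNReal.ofReal_pow (norm_nonneg _)]
  have hvol : volume ((fun ξ : ℝ => -2 * Real.pi * ξ) ⁻¹' B) =
      ENNReal.ofReal (1 / (2 * Real.pi)) * volume B := by
    rw [Real.volume_preimage_mul_left (by simp [Real.pi_ne_zero])]
    congr 2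
    rw [abs_inv, abs_mul, abs_neg, abs_two, abs_of_pos Real.pi_pos, one_div]
  calc _ = ENNReal.ofReal (1 / T) * (ENNReal.ofReal (c * N ^ (1 - 2 * α)) *
        (ENNReal.ofReal (1 / (2 * Real.pi)) * volume B)) := by
        rw [← mul_assoc, ← mul_assoc, ← ENNReal.ofReal_mul (by positivity),
          ← ENNReal.ofReal_mul (by positivity)]
        congr 2
        field_simp
    _ ≤ ENNReal.ofReal (1 / T) * ∫⁻ ξ, F ξ := by
        gcongr
        rw [← hvol]
        -- Markov's inequality for the superlevel set of `F`; monotonicity of outer measure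
        -- suffices, so `B` need not be measurable.
        refine le_trans (by gcongr) (mul_meas_ge_le_lintegral₀ ?_ _)
        exact hFm.aemeasurable
    _ = _ := hsum.symm

theorem mul_outside_probability_le_moment (V : S → ℝ) {p N : ℝ} (hp : 0 < p) (hN : 0 ≤ N) (T : ℝ) :
    ENNReal.ofReal (N ^ p) * ∑' n : {n : S // N ≤ |((n : ℤ) : ℝ)|}, timeAverage V n.1 T ≤
      moment V p T := by
  rw [← ENNReal.tsum_mul_left]
  refine le_trans ?_ (ENNReal.tsum_comp_le_tsum_of_injective
    (Subtype.val_injective (p := fun n : S => N ≤ |((n : ℤ) : ℝ)|)) fun n : S => ENNReal.ofReal (|((n : ℤ) : ℝ)| ^ p) * timeAverage V n T)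
  refine ENNReal.tsum_le_tsum fun n => ?_
  have := n.2
  gcongr

theorem moment_ge_of_outside_probability_ge {V : S → ℝ} {p N T r c : ℝ} (hp : 0 < p) (hN : 0 < N)
    (hc : 0 < c) (hT : 0 < T) {v : ℝ≥0∞}
    (h : ENNReal.ofReal (c / T * N ^ r) * v ≤
      ∑' n : {n : S // N / 2 ≤ |((n : ℤ) : ℝ)|}, timeAverage V n.1 T) :
    ENNReal.ofReal (c / 2 ^ p / T * N ^ (p + r)) * v ≤ moment V p T := by
  refine le_trans ?_ (mul_outside_probability_le_moment V hp (half_pos hN).le T)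
  calc _ = ENNReal.ofReal ((N / 2) ^ p) * (ENNReal.ofReal (c / T * N ^ r) * v) := by
        rw [← mul_assoc, ← ENNReal.ofReal_mul (by positivity), Real.div_rpow hN.le (by norm_num),
          Real.rpow_add hN]
        congr 2
        field_simp
    _ ≤ _ := by gcongr

/-- The constant `c` contributes `log c / log T`, which tends to zero. -/
theorem le_betaMinus (V : S → ℝ) {p s c : ℝ} (hc : 0 < c)
    (h : ∀ᶠ T : ℝ in atTop, ENNReal.ofReal (c * T ^ s) ≤ moment V p T) :
    (s : EReal) ≤ betaMinus V p := by
  have hlim : Tendsto (fun T : ℝ => (((Real.log c / Real.log T + s : ℝ)) : EReal)) atTop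
      (𝓝 (s : EReal)) := by
    refine (continuous_coe_real_ereal.tendsto s).comp ?_
    simpa using (Real.tendsto_log_atTop.const_div_atTop (Real.log c)).add_const s
  rw [← hlim.liminf_eq]
  refine liminf_le_liminf ?_
  filter_upwards [h, eventually_gt_atTop 1] with T hT hT1
  have hlog : 0 < Real.log T := Real.log_pos hT1
  have hT0 : 0 < T := by linarith
  have e : Real.log c / Real.log T + s = Real.log (c * T ^ s) / Real.log T := by
    rw [Real.log_mul hc.ne' (Real.rpow_pos_of_pos hT0 s).ne', Real.log_rpow hT0]
    field_simp
  rw [e, EReal.coe_div, ← ENNReal.log_ofReal_of_pos (by positivity)]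
  refine EReal.div_le_div_right_of_nonneg (by exact_mod_cast hlog.le) ?_
  exact ENNReal.log_monotone hT

end Dynamics


/-! ### Choices of energy sets and the resulting exponents -/

section Exponents
variable {S : Set ℤ}

theorem tendsto_scale {α : ℝ} (hα : 0 ≤ α) : Tendsto (scale α) atTop atTop :=
  tendsto_rpow_atTop (by positivity)

theorem exists_bounds_of_powerLawBound (hS : S = Set.univ ∨ S = Set.Ici 1) (V₀ W : S → ℝ)
    (hW : (Function.support W).Finite) {K C α : ℝ} (hK : 0 ≤ K) (hC : 0 < C) (hα : 0 ≤ α)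
    {A : ℝ → Set ℝ} (hA : PowerLawBound V₀ K C α A) :
    ∃ T₀ : ℝ, 1 < T₀ ∧
      (∃ c : ℝ, 0 < c ∧ ∀ T : ℝ, T₀ ≤ T →
        ENNReal.ofReal (c / T * scale α T ^ (1 - 2 * α)) * volume (energyNhd A α T) ≤
          ∑' n : {n : S // scale α T / 2 ≤ |((n : ℤ) : ℝ)|}, timeAverage (V₀ + W) n.1 T) ∧
      (∀ p : ℝ, 0 < p → ∃ c : ℝ, 0 < c ∧ ∀ T : ℝ, T₀ ≤ T →
        ENNReal.ofReal (c / T * scale α T ^ (p + 1 - 2 * α)) * volume (energyNhd A α T) ≤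
          moment (V₀ + W) p T) := by
  obtain ⟨c, hc, T₁, hT₁, h⟩ := outside_probability_ge hS V₀ W hW hK hC hα
  obtain ⟨T₂, hT₂⟩ := eventually_atTop.1 ((tendsto_scale hα).eventually hA)
  have main (T : ℝ) (hT : max T₁ T₂ ≤ T) :
      ENNReal.ofReal (c / T * scale α T ^ (1 - 2 * α)) * volume (energyNhd A α T) ≤
        ∑' n : {n : S // scale α T / 2 ≤ |((n : ℤ) : ℝ)|}, timeAverage (V₀ + W) n.1 T := by
    obtain ⟨-, -, hsub, hb⟩ := hT₂ T ((le_max_right _ _).trans hT)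
    exact h T ((le_max_left _ _).trans hT) (A (scale α T)) fun E hE =>
      ⟨abs_le.2 (hsub hE), fun n m _ hn hm => hb E hE n m hn hm⟩
  refine ⟨max T₁ T₂, lt_max_of_lt_left hT₁, ⟨c, hc, main⟩, fun p hp =>
    ⟨c / 2 ^ p, by positivity, fun T hT => ?_⟩⟩
  have hT0 : 0 < T := by linarith [(le_max_left _ _).trans hT]
  rw [add_sub_assoc]
  exact moment_ge_of_outside_probability_ge hp (Real.rpow_pos_of_pos hT0 _) hc hT0 (main T hT)

/-- The three terms of `s` are the powers of `T` coming from `N(T)^(p+1-2α)`, from the prefactor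
`1/T` and from `|B(T)|`. -/
theorem PowerLawBound.le_betaMinus (hS : S = Set.univ ∨ S = Set.Ici 1) {V₀ : S → ℝ} (W : S → ℝ)
    (hW : (Function.support W).Finite) {K C α : ℝ} (hK : 0 ≤ K) (hC : 0 < C) (hα : 0 ≤ α)
    {A : ℝ → Set ℝ} (hA : PowerLawBound V₀ K C α A) {p s q b : ℝ} (hp : 0 < p) (hb : 0 < b)
    (hvol : ∀ᶠ T in atTop, ENNReal.ofReal (b * T ^ q) ≤ volume (energyNhd A α T))
    (hs : s = (p + 1 - 2 * α) / (1 + α) - 1 + q) : (s : EReal) ≤ betaMinus (V₀ + W) p := by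
  obtain ⟨T₀, hT₀, -, h⟩ := exists_bounds_of_powerLawBound hS V₀ W hW hK hC hα hA
  obtain ⟨c, hc, h⟩ := h p hp
  refine Schrodinger.le_betaMinus (c := c * b) _ (by positivity) ?_
  filter_upwards [hvol, eventually_ge_atTop T₀] with T hv hT
  have hT0 : 0 < T := by linarith
  refine le_trans (le_of_eq ?_) ((mul_le_mul_right hv _).trans (h T hT))
  have hsc : 0 ≤ scale α T := Real.rpow_nonneg hT0.le _
  rw [← ENNReal.ofReal_mul (by positivity)]
  congr 1
  rw [hs, scale, ← Real.rpow_mul hT0.le, Real.rpow_add hT0, Real.rpow_sub hT0, Real.rpow_one,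
    one_div_mul_eq_div]
  ring

/-- Power-law bounds at a single energy. -/
theorem powerLawBound_singleton {V : S → ℝ} {E₀ C α : ℝ} (hα : 0 ≤ α)
    (h : ∀ n m : S, ((n : ℤ), (m : ℤ)) ≠ (0, 0) →
      ‖transfer V n m (E₀ : ℂ)‖ ≤ C * (|((n : ℤ) : ℝ)| + |((m : ℤ) : ℝ)|) ^ α) :
    PowerLawBound V |E₀| (max C 1 * 2 ^ α) α fun _ => {E₀} := by
  filter_upwards [eventually_ge_atTop 1] with N hN
  refine ⟨Set.singleton_nonempty _, measurableSet_singleton _, ?_, ?_⟩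
  · rintro _ rfl; exact abs_le.1 le_rfl
  · rintro _ rfl n m hn hm
    -- The factor `2^α` comes from `|n| + |m| ≤ 2N`; the maximum with 1 handles `n = m = 0`, where
    -- the matrix is the identity, and keeps the constant positive.
    rw [mul_assoc, ← Real.mul_rpow (by norm_num) (by linarith)]
    by_cases h0 : ((n : ℤ), (m : ℤ)) = (0, 0)
    · obtain ⟨h1, h2⟩ := Prod.mk.inj h0
      rw [h1, h2, transfer, if_pos le_rfl, sub_self, Int.toNat_zero, stepProduct, CStarRing.norm_one]
      have : 1 ≤ (2 * N) ^ α := Real.one_le_rpow (by linarith) hα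
      nlinarith [le_max_right C 1]
    · refine (h n m h0).trans ?_
      have : (|((n : ℤ) : ℝ)| + |((m : ℤ) : ℝ)|) ^ α ≤ (2 * N) ^ α := by gcongr; linarith
      exact mul_le_mul (le_max_left _ _) this (by positivity) (by positivity)

/-- Bounded transfer matrices in shrinking neighbourhoods of an energy. -/
theorem powerLawBound_Icc {V : S → ℝ} {C E₀ θ : ℝ} (hC : 0 < C) (hθ : 1 ≤ θ)
    (h : ∀ (n : S) (E : ℝ), (n : ℤ) ≠ 0 → |((n : ℤ) : ℝ)| * |E - E₀| ^ θ ≤ 1 →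
      ‖transfer V n 1 (E : ℂ)‖ ≤ C) :
    ∃ C', 0 < C' ∧ PowerLawBound V (|E₀| + 1) C' 0
      fun N => Set.Icc (E₀ - N ^ (-(1 / θ))) (E₀ + N ^ (-(1 / θ))) := by
  have hs0 := norm_nonneg (stepMatrix V 1 0)
  -- The second summand bounds the transfer matrix from site 1 to site 0 for all `|E| ≤ |E₀| + 1`.
  set D := C + 3 * (‖stepMatrix V 1 0‖ + (|E₀| + 1)) with hD
  have hD0 : 0 < D := by positivity
  refine ⟨D * (3 * D), by positivity, ?_⟩
  filter_upwards [eventually_ge_atTop 1] with N hN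
  have hN0 : 0 < N := by linarith
  have hr : 0 < N ^ (-(1 / θ)) := Real.rpow_pos_of_pos hN0 _
  have hr1 : N ^ (-(1 / θ)) ≤ 1 := Real.rpow_le_one_of_one_le_of_nonpos hN (by
    rw [neg_nonpos]; positivity)
  have hdist (E : ℝ) (hE : E ∈ Set.Icc (E₀ - N ^ (-(1 / θ))) (E₀ + N ^ (-(1 / θ)))) :
      |E - E₀| ≤ N ^ (-(1 / θ)) := by
    rw [abs_le]; constructor <;> linarith [hE.1, hE.2]
  have habs (E : ℝ) (hE : |E - E₀| ≤ N ^ (-(1 / θ))) : |E| ≤ |E₀| + 1 := by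
    have := abs_sub_abs_le_abs_sub E E₀
    linarith
  refine ⟨Set.nonempty_Icc.2 (by linarith), measurableSet_Icc,
    fun E hE => abs_le.1 (habs E (hdist E hE)), fun E hE n m hn hm => ?_⟩
  have hE := hdist E hE
  have hone (n : S) (hn : |((n : ℤ) : ℝ)| ≤ N) : ‖transfer V n 1 (E : ℂ)‖ ≤ D := by
    by_cases h0 : (n : ℤ) = 0
    · rw [h0]
      refine (norm_transfer_zero_one_le V E).trans ?_
      rw [Complex.norm_real, Real.norm_eq_abs]
      linarith [habs E hE]
    · refine (h n E h0 ?_).trans (by rw [hD]; linarith [abs_nonneg E₀])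
      calc |((n : ℤ) : ℝ)| * |E - E₀| ^ θ ≤ N * (N ^ (-(1 / θ))) ^ θ := by gcongr
        _ = 1 := by
          rw [← Real.rpow_mul hN0.le, neg_mul, one_div_mul_cancel (by positivity), Real.rpow_neg_one,
            mul_inv_cancel₀ hN0.ne']
  rw [Real.rpow_zero, mul_one]
  have hn1 := hone n hn
  have hm1 := hone m hm
  refine (norm_transfer_le V n m E).trans ?_
  gcongr

end Exponents

end Schrodinger

/-! ### The main theorem -/

theorem corollary3 (S : Set ℤ) (hS : S = Set.univ ∨ S = Set.Ici 1)
    (V₀ W : S → ℝ) (hW : (Function.support W).Finite) :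
    -- the power-law hypothesis for `V₀` gives the dynamical bounds for `V₀ + W`
    (∀ K C α : ℝ, 0 < K → 0 < C → 0 < α → ∀ A : ℝ → Set ℝ,
      Schrodinger.PowerLawBound V₀ K C α A →
      ∃ T₀ : ℝ, 1 < T₀ ∧
        (∃ c : ℝ, 0 < c ∧ ∀ T : ℝ, T₀ ≤ T →
          ENNReal.ofReal (c / T * Schrodinger.scale α T ^ (1 - 2 * α)) *
              volume (Schrodinger.energyNhd A α T) ≤
            ∑' n : {n : S // Schrodinger.scale α T / 2 ≤ |((n : ℤ) : ℝ)|},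
              Schrodinger.timeAverage (V₀ + W) n.1 T) ∧
        (∀ p : ℝ, 0 < p → ∃ c : ℝ, 0 < c ∧ ∀ T : ℝ, T₀ ≤ T →
          ENNReal.ofReal (c / T * Schrodinger.scale α T ^ (p + 1 - 2 * α)) *
              volume (Schrodinger.energyNhd A α T) ≤
            Schrodinger.moment (V₀ + W) p T)) ∧
    -- the one-energy hypothesis for `V₀` gives the bound on the growth exponents for `V₀ + W`
    (∀ E₀ C α : ℝ, 0 ≤ α →
      (∀ n m : S, ((n : ℤ), (m : ℤ)) ≠ (0, 0) →
        ‖Schrodinger.transfer V₀ n m (E₀ : ℂ)‖ ≤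
          C * (|((n : ℤ) : ℝ)| + |((m : ℤ) : ℝ)|) ^ α) →
      ∀ p : ℝ, 0 < p →
        (((p - 1 - 4 * α) / (1 + α) : ℝ) : EReal) ≤ Schrodinger.betaMinus (V₀ + W) p) ∧
    -- bounded transfer matrices near one energy for `V₀`
    (∀ C E₀ θ : ℝ, 0 < C → 1 ≤ θ →
      (∀ (n : S) (E : ℝ), (n : ℤ) ≠ 0 → |((n : ℤ) : ℝ)| * |E - E₀| ^ θ ≤ 1 →
        ‖Schrodinger.transfer V₀ n 1 (E : ℂ)‖ ≤ C) →
      ∀ p : ℝ, 0 < p →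
        ((p - 1 / θ : ℝ) : EReal) ≤ Schrodinger.betaMinus (V₀ + W) p) := by
  refine ⟨fun K C α hK hC hα A hA =>
    Schrodinger.exists_bounds_of_powerLawBound hS V₀ W hW hK.le hC hα.le hA,
    fun E₀ C α hα h p hp => ?_, fun C E₀ θ hC hθ h p hp => ?_⟩
  -- For a single energy, `B(T)` is an interval of length `2 T^(-1)`.
  · refine (Schrodinger.powerLawBound_singleton hα h).le_betaMinus hS W hW (abs_nonneg _)
      (by positivity) hα hp (q := -1) (b := 2) (by norm_num) ?_ ?_
    · refine Eventually.of_forall fun T => le_of_eq ?_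
      have e : Schrodinger.energyNhd (fun _ => {E₀}) α T = Set.Icc (E₀ - 1 / T) (E₀ + 1 / T) := by
        ext E
        simp only [Schrodinger.energyNhd, Set.mem_singleton_iff, exists_eq_left,
          Set.mem_ofPred_eq, abs_le, Set.mem_Icc]
        constructor <;> rintro ⟨h1, h2⟩ <;> constructor <;> linarith
      rw [e, Real.volume_Icc, Real.rpow_neg_one]
      congr 1
      ring
    · field_simp
      ring
  · obtain ⟨C', hC', hA⟩ := Schrodinger.powerLawBound_Icc hC hθ h
    -- Here `α = 0`, so `N(T) = T` and `B(T)` contains the interval `A(T)` of length `2 T^(-1/θ)`.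
    refine hA.le_betaMinus hS W hW (by positivity) hC' le_rfl hp (q := -(1 / θ)) (b := 2)
      (by norm_num) ?_ (by ring)
    filter_upwards [eventually_gt_atTop 0] with T hT
    have e : Schrodinger.scale 0 T = T := by simp [Schrodinger.scale]
    calc _ = volume (Set.Icc (E₀ - T ^ (-(1 / θ))) (E₀ + T ^ (-(1 / θ)))) := by
          rw [Real.volume_Icc]
          congr 1
          ring
      _ ≤ _ := by
        refine measure_mono fun E hE => ?_
        exact ⟨E, by rwa [e], by simp [hT.le]⟩
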